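/- Let $(X,d)$ be a metric space, and write $B(x,r)$ for open balls, $B=B(x,r)$, $\sigma B=B(x,\sigma r)$, $f_B=\frac1{\mu(B)}\int_B f\,d\mu$. For $Q>0$ let $\mathcal H^Q(A)=\lim_{\delta\to0}\inf\{\sum_i \operatorname{diam}(A_i)^Q: A\subseteq\bigcup_{i=1}^\infty A_i,\ \operatorname{diam}(A_i)\le\delta\}$ be the $Q$-dimensional Hausdorff measure. Let $p\in(1,\infty)$ and $\beta>0$. A tuple $(X,d,\mu,\mathcal E,\mathcal F,\Gamma)$ is a *$(p,\beta)$-Poincaré–Dirichlet space* if: 1. $(X,d)$ is complete and locally compact, and $\mu$ is a Radon measure on $X$; 2. $\mathcal F$ is a linear subspace of $L^p(X,\mu)$ and $\mathcal E:\mathcal F\to[0,\infty)$ is such that $\|f\|_{\mathcal F}=(\|f\|_{L^p}^p+\mathcal E(f))^{1/p}$ is a norm making $\mathcal F$ a Banach space; 3. to each $f\in\mathcal F$ is assigned a finite Borel measure $\Gamma\langle f\rangle$ with $\Gamma\langle f\rangle(X)=\mathcal E(f)$ and $\Gamma\langle\lambda f\rangle=|\lambda|^p\Gamma\langle f\rangle$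 for all $\lambda\in\mathbb R$; 4. $\Gamma\langle f+g\rangle(A)^{1/p}\le\Gamma\langle f\rangle(A)^{1/p}+\Gamma\langle g\rangle(A)^{1/p}$ for all $f,g\in\mathcal F$ and all Borel sets $A\subseteq X$; 5. for $f\in\mathcal F$ and every $1$-Lipschitz $\varphi:\mathbb R\to\mathbb R$ with $\varphi(0)=0$, one has $\varphi\circ f\in\mathcal F$ and $\Gamma\langle\varphi\circ f\rangle\le\Gamma\langle f\rangle$; 6. if $f\in\mathcal F$, $A\subseteq X$ is open, $c\in\mathbb R$ and $(f-c)\mathbf 1_A=0$ $\mu$-a.e., then $\Gamma\langle f\rangle(A)=0$; 7. if $f_i\in\mathcal F$, $f_i\to f$ in $L^p(X,\mu)$ and $\sup_i\mathcal E(f_i)<\infty$, then $f\in\mathcal F$ and $\Gamma\langle f\rangle(A)\le\liminf_{i\to\infty}\Gamma\langle f_i\rangle(A)$ for every Borel set $A\subseteq X$; 8. there is $D\ge1$ with $0<\mu(B(x,2r))\le D\,\mu(B(x,r))<\infty$ for all $x\in X$, $r>0$; 9. there are $C,\sigma\ge1$ with $\int_B|f-f_B|^p\,d\mu\le C\,r^\beta\,\Gamma\langle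 f\rangle(\sigma B)$ for all balls $B=B(x,r)$, $x\in X$, $r>0$, and all $f\in\mathcal F$; 10. there is $C\ge1$ such that for every ball $B=B(x,r)$, $x\in X$, $r>0$, there is a continuous $\varphi\in\mathcal F$ with $\varphi=1$ on $B$, $\varphi=0$ on $X\setminus2B$ and $\mathcal E(\varphi)\le C\mu(B)/r^\beta$. A Radon measure $\Lambda$ on $X$ is *energy dominant* if $\Gamma\langle f\rangle\ll\Lambda$ for every $f\in\mathcal F$, and *minimal energy dominant* if moreover $\Lambda\ll\nu$ for every energy dominant Radon measure $\nu$. **Proposition.** Let $p\in(1,\infty)$, $\beta>0$, $d_{\mathrm H}>0$, and let $(X,d,\mu,\mathcal E,\mathcal F,\Gamma)$ be a $(p,\beta)$-Poincaré–Dirichlet space such that - $(X,d)$ is compact; - $\mu=\mathcal H^{d_{\mathrm H}}$, and $(X,d)$ is $d_{\mathrm H}$-Ahlfors regular: there is $C\ge1$ with $C^{-1}r^{d_{\mathrm H}}\le\mathcal H^{d_{\mathrm H}}(B(x,r))\le Cr^{d_{\mathrm H}}$ for all $x\in X$ and $0<r\le2\operatorname{diam}(X)$; - $(X,d)$ is of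 bounded turning: there is $K\ge1$ such that any $x,y\in X$ lie on a curve (continuous image of $[0,1]$) of diameter at most $K\,d(x,y)$; - $(X,d)$ is geodesic: any $x,y\in X$ are joined by a curve of length $d(x,y)$; - $\beta>p$. Then every minimal energy dominant measure $\Lambda$ of $(X,d,\mu,\mathcal E,\mathcal F,\Gamma)$ is mutually singular with $\mu$, i.e. $\Lambda\perp\mu$. -/

import Mathlib

open MeasureTheory Filter Topology
open scoped ENNReal NNReal

noncomputable section

namespace PDirichlet

/-- `(X, d)` is `Q`-Ahlfors regular: `C⁻¹ r^Q ≤ H^Q(B(x,r)) ≤ C r^Q` for all `x` and all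
`0 < r ≤ 2 diam X`. The diameter is the extended one, so that an unbounded space is treated
correctly. Mathlib's Hausdorff measure `μH[Q]` is the one built from the sums `∑ diam(A_i)^Q`,
without a normalizing factor. -/
def IsAhlforsRegular (X : Type*) [MetricSpace X] [MeasurableSpace X] [BorelSpace X]
    (Q : ℝ) : Prop :=
  ∃ C : ℝ, 1 ≤ C ∧ ∀ (x : X) (r : ℝ), 0 < r →
    ENNReal.ofReal r ≤ 2 * Metric.ediam (Set.univ : Set X) →
      ENNReal.ofReal (C⁻¹ * r ^ Q) ≤ μH[Q] (Metric.ball x r) ∧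
        μH[Q] (Metric.ball x r) ≤ ENNReal.ofReal (C * r ^ Q)

/-- `(X, d)` is geodesic: any two points are joined by a curve `[0,1] → X` whose length is the
distance of the points. The length of a curve is its total variation. -/
def IsGeodesic (X : Type*) [MetricSpace X] : Prop :=
  ∀ x y : X, ∃ γ : Path x y, eVariationOn γ Set.univ = edist x y

/-- `(X, d)` is of bounded turning. -/
def IsBoundedTurning (X : Type*) [MetricSpace X] : Prop :=
  ∃ K : ℝ, 1 ≤ K ∧ ∀ x y : X, ∃ γ : C(unitInterval, X),
    x ∈ Set.range γ ∧ y ∈ Set.range γ ∧ Metric.diam (Set.range γ) ≤ K * dist x y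

/-- Radon measures on a metric space: Borel measures that are locally finite, outer regular on
Borel sets and inner regular for compact sets on open sets. -/
structure IsRadon {X : Type*} [MetricSpace X] [MeasurableSpace X] [BorelSpace X]
    (ν : Measure X) : Prop where
  locallyFinite : IsLocallyFiniteMeasure ν
  regular : ν.Regular

/-- `μ` is volume doubling. -/
def IsVolumeDoubling {X : Type*} [MetricSpace X] [MeasurableSpace X] (μ : Measure X) : Prop :=
  ∃ D : ℝ≥0, 1 ≤ D ∧ ∀ (x : X) (r : ℝ), 0 < r →
    0 < μ (Metric.ball x (2 * r)) ∧
      μ (Metric.ball x (2 * r)) ≤ D * μ (Metric.ball x r) ∧ μ (Metric.ball x r) < ∞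

/-- The data `(𝓕, 𝓔, Γ)` on a metric measure space `(X, d, μ)`: a linear subspace `F` of
`L^p(X, μ)`, a non-negative function `E` on `F`, and for each `f ∈ F` a Borel measure `Γ f`.
The laws are in `IsDirichletSpace` and `IsPoincareDirichletSpace`. -/
structure EnergyData (X : Type*) [MetricSpace X] [MeasurableSpace X] (p : ℝ)
    (μ : Measure X) where
  F : Submodule ℝ (Lp ℝ (ENNReal.ofReal p) μ)
  E : F → ℝ≥0
  Γ : F → Measure X

variable {X : Type*} [MetricSpace X] [MeasurableSpace X] [BorelSpace X]
  {p : ℝ} {μ : Measure X}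

/-- `‖f‖_F = (‖f‖_{L^p}^p + E(f))^{1/p}`. -/
def EnergyData.normF (S : EnergyData X p μ) (f : S.F) : ℝ :=
  (‖(f : Lp ℝ (ENNReal.ofReal p) μ)‖ ^ p + (S.E f : ℝ)) ^ (1 / p)

/-- `(X, d, μ, E, F, Γ)` is a `p`-Dirichlet space. -/
structure IsDirichletSpace (S : EnergyData X p μ) : Prop where
  /-- the metric space is complete -/
  complete : CompleteSpace X
  /-- the metric space is locally compact -/
  locallyCompact : LocallyCompactSpace X
  /-- the reference measure is Radon -/
  radon : IsRadon μ
  /-- `normF` is a norm on `F` (that it separates points is clear from its definition) ... -/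
  normF_add_le : ∀ f g : S.F, S.normF (f + g) ≤ S.normF f + S.normF g
  normF_smul : ∀ (a : ℝ) (f : S.F), S.normF (a • f) = |a| * S.normF f
  /-- ... and `F` is complete in it -/
  normF_complete : ∀ u : ℕ → S.F,
    (∀ ε : ℝ, 0 < ε → ∃ N : ℕ, ∀ m ≥ N, ∀ n ≥ N, S.normF (u m - u n) < ε) →
      ∃ f : S.F, Tendsto (fun n => S.normF (u n - f)) atTop (𝓝 0)
  /-- the total mass of the energy measure is the (finite) energy -/
  Γ_univ : ∀ f : S.F, S.Γ f Set.univ = (S.E f : ℝ≥0∞)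
  /-- homogeneity -/
  Γ_smul : ∀ (a : ℝ) (f : S.F), S.Γ (a • f) = ENNReal.ofReal (|a| ^ p) • S.Γ f
  /-- triangle inequality -/
  Γ_add_le : ∀ (f g : S.F) (A : Set X), MeasurableSet A →
    (S.Γ (f + g) A) ^ (1 / p) ≤ (S.Γ f A) ^ (1 / p) + (S.Γ g A) ^ (1 / p)
  /-- Lipschitz contractivity; `hφ.compLp h0 f` is the class of `φ ∘ f` in `L^p` -/
  lipschitz : ∀ (f : S.F) (φ : ℝ → ℝ) (hφ : LipschitzWith 1 φ) (h0 : φ 0 = 0),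
    ∃ h : hφ.compLp h0 (f : Lp ℝ (ENNReal.ofReal p) μ) ∈ S.F, S.Γ ⟨_, h⟩ ≤ S.Γ f
  /-- strong locality: the energy measure of `f` does not charge an open set on which `f` is
  constant almost everywhere -/
  strongly_local : ∀ (f : S.F) (A : Set X), IsOpen A → ∀ c : ℝ,
    (∀ᵐ x ∂μ, x ∈ A → (f : Lp ℝ (ENNReal.ofReal p) μ) x = c) → S.Γ f A = 0
  /-- weak lower semicontinuity -/
  lower_semicontinuous : ∀ (f : Lp ℝ (ENNReal.ofReal p) μ) (u : ℕ → S.F),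
    Tendsto (fun i => ‖(u i : Lp ℝ (ENNReal.ofReal p) μ) - f‖) atTop (𝓝 0) →
    BddAbove (Set.range fun i => S.E (u i)) →
      ∃ h : f ∈ S.F, ∀ A : Set X, MeasurableSet A →
        S.Γ ⟨f, h⟩ A ≤ liminf (fun i => S.Γ (u i) A) atTop

/-- `(X, d, μ, E, F, Γ)` is a `(p, β)`-Poincaré–Dirichlet space: a `p`-Dirichlet space with
volume doubling, the Poincaré inequality and the upper capacity bound for the scale function
`Ψ(r) = r^β`. -/
structure IsPoincareDirichletSpace (S : EnergyData X p μ) (β : ℝ) : Prop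
    extends IsDirichletSpace S where
  doubling : IsVolumeDoubling μ
  poincare : ∃ C σ : ℝ, 1 ≤ C ∧ 1 ≤ σ ∧ ∀ (x : X) (r : ℝ), 0 < r → ∀ f : S.F,
    ∫ y in Metric.ball x r, |(f : Lp ℝ (ENNReal.ofReal p) μ) y -
        ⨍ z in Metric.ball x r, (f : Lp ℝ (ENNReal.ofReal p) μ) z ∂μ| ^ p ∂μ
      ≤ C * r ^ β * (S.Γ f).real (Metric.ball x (σ * r))
  capacity : ∃ C : ℝ, 1 ≤ C ∧ ∀ (x : X) (r : ℝ), 0 < r →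
    ∃ (φ : X → ℝ) (g : S.F), Continuous φ ∧ (g : Lp ℝ (ENNReal.ofReal p) μ) =ᵐ[μ] φ ∧
      (∀ y ∈ Metric.ball x r, φ y = 1) ∧ (∀ y ∉ Metric.ball x (2 * r), φ y = 0) ∧
      (S.E g : ℝ) ≤ C * (μ.real (Metric.ball x r) / r ^ β)

/-- A Radon measure is energy dominant if all energy measures are absolutely continuous with
respect to it. -/
structure IsEnergyDominant (S : EnergyData X p μ) (Λ : Measure X) : Prop where
  radon : IsRadon Λ
  dominates : ∀ f : S.F, S.Γ f ≪ Λ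

/-- An energy dominant measure is minimal if it is absolutely continuous with respect to every
energy dominant measure. -/
structure IsMinimalEnergyDominant (S : EnergyData X p μ) (Λ : Measure X) : Prop
    extends IsEnergyDominant S Λ where
  minimal : ∀ ν : Measure X, IsEnergyDominant S ν → Λ ≪ ν

end PDirichlet

end

/-! Fix f in F, write Q for the dimension, and suppose Γ⟨f⟩(B(a,t)) ≤ M t^Q for all a in a set A and
all t > 0. Near A the Poincaré inequality at scale s makes averages of f over neighbouring balls of
radius s differ by at most a constant times (M s^β)^{1/p}, since the mass bound M s^Q cancels the
volume of the ball. In a geodesic space, points at distance about r = ns are joined by about n steps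
of length s. So where A is s-dense, averages at distance about r differ by at most a constant times
n (M s^β)^{1/p}.

Discretize f as Σ a_k ψ_k, with a_k averages over balls of radius r/n around an r-net and ψ_k a
partition of unity built from the capacity bound. In each such ball of radius r its energy is at
most a constant times r^{Q-β} n^p M (r/n)^β = M n^{p-β} r^Q. Summing over the net bounds the energy
of the set D of points near which A is dense by a constant times M n^{p-β}
(`exists_discretization`). With n fixed and r → 0 the discretizations converge to f in L^p with
bounded energy, so lower semicontinuity transfers the bound to Γ⟨f⟩(D) (`exists_energy_le`). As β >
p, letting n → ∞ gives mass zero.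

These sets exhaust X up to a μ-null set: differentiation of measures gives a finite M at almost
every point (`ae_exists_density_bound`), and near a density point of A the set A is r/n-dense at all
small scales r (`ae_infDist_le`). Hence Γ⟨f⟩ ⊥ μ for every f. The μ-absolutely continuous part of Λ
can then be discarded without losing energy dominance, so minimality makes it vanish. -/

namespace PDirichlet

/-! ### Geodesic chains, nets, and counting by volume -/

section Metric

variable {X : Type*} [MetricSpace X]

/-- Along a curve whose length is the distance of its endpoints, distances are differences of the
distances to the initial point. -/
theorem dist_le_of_eVariationOn_eq {x y : X} (γ : Path x y)
    (h : eVariationOn γ Set.univ = edist x y) {u v : unitInterval} (huv : u ≤ v) :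
    dist (γ u) (γ v) ≤ dist x (γ v) - dist x (γ u) := by
  have h1 : edist x (γ u) ≤ eVariationOn γ (Set.Iic u) := by
    have := eVariationOn.edist_le (γ : unitInterval → X) (s := Set.Iic u) (x := 0) (y := u)
      unitInterval.nonneg' (le_refl u)
    simpa using this
  have h2 : edist (γ u) (γ v) ≤ eVariationOn γ (Set.Icc u v) :=
    eVariationOn.edist_le (γ : unitInterval → X) (s := Set.Icc u v) ⟨le_rfl, huv⟩ ⟨huv, le_rfl⟩
  have h3 : edist (γ v) y ≤ eVariationOn γ (Set.Ici v) := by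
    have := eVariationOn.edist_le (γ : unitInterval → X) (s := Set.Ici v) (x := v) (y := 1)
      (le_refl v) unitInterval.le_one'
    simpa using this
  -- Variation is superadditive over consecutive parameter intervals, so passing through `γ u` and
  -- `γ v` costs no extra length. The triangle inequality through `γ v` then finishes.
  have h4 : edist x (γ u) + edist (γ u) (γ v) + edist (γ v) y ≤ edist x y := by
    calc edist x (γ u) + edist (γ u) (γ v) + edist (γ v) y
        ≤ eVariationOn γ (Set.Iic u) + eVariationOn γ (Set.Icc u v) + eVariationOn γ (Set.Ici v) := by
          gcongr
      _ ≤ eVariationOn γ (Set.Iic u ∪ Set.Icc u v) + eVariationOn γ (Set.Ici v) := by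
          gcongr
          exact eVariationOn.add_le_union _ fun a ha b hb => le_trans ha hb.1
      _ ≤ eVariationOn γ ((Set.Iic u ∪ Set.Icc u v) ∪ Set.Ici v) := by
          apply eVariationOn.add_le_union
          rintro a (ha | ha) b hb
          · exact (le_trans ha huv).trans hb
          · exact le_trans ha.2 hb
      _ ≤ eVariationOn γ Set.univ := eVariationOn.mono _ (Set.subset_univ _)
      _ = edist x y := h
  rw [edist_dist, edist_dist, edist_dist, edist_dist, ← ENNReal.ofReal_add (by positivity)
    (by positivity), ← ENNReal.ofReal_add (by positivity) (by positivity),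
    ENNReal.ofReal_le_ofReal_iff (by positivity)] at h4
  linarith [dist_triangle x (γ v) y]

/-- In a geodesic space any two points are joined by a chain of `m` equal steps. -/
theorem IsGeodesic.exists_chain (h : IsGeodesic X) (x y : X) {m : ℕ} (hm : 0 < m) :
    ∃ z : ℕ → X, z 0 = x ∧ z m = y ∧ (∀ j ≤ m, dist x (z j) ≤ dist x y) ∧
      ∀ j < m, dist (z j) (z (j + 1)) ≤ dist x y / m := by
  obtain ⟨γ, hγ⟩ := h x y
  have hm' : (0 : ℝ) < m := by exact_mod_cast hm
  have hkey : ∀ u v : unitInterval, dist (γ u) (γ v) ≤ |dist x (γ v) - dist x (γ u)| := by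
    intro u v
    rcases le_total u v with huv | huv
    · exact (dist_le_of_eVariationOn_eq γ hγ huv).trans (le_abs_self _)
    · rw [dist_comm, abs_sub_comm]
      exact (dist_le_of_eVariationOn_eq γ hγ huv).trans (le_abs_self _)
  -- The intermediate value theorem for the distance to `x` along the curve.
  have hex : ∀ j : ℕ, ∃ u : unitInterval, j ≤ m → dist x (γ u) = j * (dist x y / m) := by
    intro j
    by_cases hj : j ≤ m
    · have hj' : (j : ℝ) ≤ m := by exact_mod_cast hj
      have hc : Continuous fun u : unitInterval => dist x (γ u) := by fun_prop
      have := mem_range_of_exists_le_of_exists_ge hc (c := j * (dist x y / m))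
        ⟨0, by simp; positivity⟩ ⟨1, by
          simp only [Path.target]
          rw [mul_div_assoc', div_le_iff₀ hm', mul_comm]
          exact mul_le_mul_of_nonneg_left hj' dist_nonneg⟩
      obtain ⟨u, hu⟩ := this
      exact ⟨u, fun _ => hu⟩
    · exact ⟨0, fun h => absurd h hj⟩
  choose u hu using hex
  refine ⟨fun j => γ (u j), ?_, ?_, ?_, ?_⟩
  · have := hu 0 (Nat.zero_le _)
    simp only [Nat.cast_zero, zero_mul] at this
    exact (dist_eq_zero.1 this).symm
  · have h1 := hu m le_rfl
    have h2 := hkey (u m) 1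
    rw [h1, Path.target, mul_div_cancel₀ _ hm'.ne', sub_self, abs_zero] at h2
    exact dist_le_zero.1 h2
  · intro j hj
    have hj' : (j : ℝ) ≤ m := by exact_mod_cast hj
    rw [hu j hj, mul_div_assoc', div_le_iff₀ hm', mul_comm]
    exact mul_le_mul_of_nonneg_left hj' dist_nonneg
  · intro j hj
    refine (hkey _ _).trans ?_
    rw [hu j hj.le, hu (j + 1) hj, ← sub_mul]
    push_cast
    rw [add_sub_cancel_left, one_mul, abs_of_nonneg (by positivity)]

/-- A compact space has finite nets at every scale. -/
theorem exists_net [CompactSpace X] [Nonempty X] {r : ℝ} (hr : 0 < r) :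
    ∃ (N : ℕ) (x : ℕ → X), (∀ i < N, ∀ j < N, i ≠ j → r / 2 < dist (x i) (x j)) ∧
      ∀ y, ∃ i < N, dist y (x i) < r := by
  classical
  -- A maximal 2ε-separated set is also a 2ε-cover. With 2ε = r/2 this gives both strict
  -- inequalities of the net.
  obtain ⟨ε, hε⟩ : ∃ ε : ℝ≥0, (ε : ℝ) = r / 4 :=
    ⟨(r / 4).toNNReal, Real.coe_toNNReal _ (by positivity)⟩
  have hε0 : ε ≠ 0 := by
    rintro rfl
    simp only [NNReal.coe_zero] at hε
    linarith
  have hfin : Metric.packingNumber (2 * ε) (Set.univ : Set X) ≠ ⊤ := by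
    obtain ⟨T, -, hTf, hT⟩ := Metric.exists_finite_isCover_of_isCompact hε0
      (isCompact_univ (X := X))
    refine ne_top_of_le_ne_top ?_
      ((Metric.packingNumber_two_mul_le_externalCoveringNumber ε (Set.univ : Set X)).trans
        hT.externalCoveringNumber_le_encard)
    simpa using hTf
  set T := Metric.maximalSeparatedSet (2 * ε) (Set.univ : Set X)
  have hTf : T.Finite := by
    rw [← Set.encard_ne_top_iff, Metric.encard_maximalSeparatedSet hfin]
    exact hfin
  have hsep : Metric.IsSeparated (2 * ε : ℝ≥0) T := Metric.isSeparated_maximalSeparatedSet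
  have hcov := Metric.isCover_maximalSeparatedSet hfin
  have h2ε : ((2 * ε : ℝ≥0) : ℝ) = r / 2 := by
    rw [NNReal.coe_mul, hε, NNReal.coe_ofNat]
    ring
  have hF := hTf.toFinset.equivFin
  set n := hTf.toFinset.card
  refine ⟨n, fun i => if h : i < n then (hF.symm ⟨i, h⟩ : X) else Classical.arbitrary X, ?_, ?_⟩
  · intro i hi j hj hij
    have hne : (hF.symm ⟨i, hi⟩ : X) ≠ hF.symm ⟨j, hj⟩ := by
      intro h
      have := hF.symm.injective (Subtype.ext h)
      exact hij (by simpa using this)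
    have : ((2 * ε : ℝ≥0) : ℝ≥0∞) < edist (hF.symm ⟨i, hi⟩ : X) (hF.symm ⟨j, hj⟩) :=
      hsep (hTf.mem_toFinset.1 (hF.symm ⟨i, hi⟩).2) (hTf.mem_toFinset.1 (hF.symm ⟨j, hj⟩).2) hne
    simp only [hi, hj, dif_pos]
    rw [edist_dist, ← ENNReal.ofReal_coe_nnreal, h2ε,
      ENNReal.ofReal_lt_ofReal_iff_of_nonneg (by positivity)] at this
    exact this
  · intro y
    obtain ⟨w, hw, hyw⟩ := hcov (Set.mem_univ y)
    have hd : dist y w ≤ r / 2 := by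
      have h' : edist y w ≤ ((2 * ε : ℝ≥0) : ℝ≥0∞) := hyw
      rwa [edist_dist, ← ENNReal.ofReal_coe_nnreal, h2ε,
        ENNReal.ofReal_le_ofReal_iff (by positivity)] at h'
    refine ⟨hF ⟨w, hTf.mem_toFinset.2 hw⟩, (hF ⟨w, hTf.mem_toFinset.2 hw⟩).2, ?_⟩
    simp only [Fin.is_lt, dif_pos, Fin.eta, Equiv.symm_apply_apply]
    linarith

variable [MeasurableSpace X] [BorelSpace X]

/-- Bounds on the number of separated points in a ball of a space with two-sided volume bounds. -/
theorem card_le_of_separated {μ : Measure X} [IsFiniteMeasure μ] {c C Q R : ℝ} (hc : 0 < c)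
    (hlow : ∀ (x : X) (r : ℝ), 0 < r → r ≤ R → c * r ^ Q ≤ μ.real (Metric.ball x r))
    (hup : ∀ (x : X) (r : ℝ), 0 < r → μ.real (Metric.ball x r) ≤ C * r ^ Q)
    {r l : ℝ} (hr : 0 < r) (hrR : r ≤ R) (hl : 0 < l) (s : Finset ℕ) (x : ℕ → X) (y : X)
    (hsep : ∀ i ∈ s, ∀ j ∈ s, i ≠ j → r / 2 < dist (x i) (x j))
    (hs : ∀ i ∈ s, dist (x i) y < l * r) :
    (s.card : ℝ) ≤ C / c * (4 * (l + 1)) ^ Q := by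
  -- Volume comparison: disjoint balls of radius r/4 inside one ball of radius (l+1)r.
  have hdisj : (s : Set ℕ).PairwiseDisjoint fun i => Metric.ball (x i) (r / 4) := by
    intro i hi j hj hij
    exact Metric.ball_disjoint_ball (by linarith [hsep i hi j hj hij])
  have hsub : ⋃ i ∈ s, Metric.ball (x i) (r / 4) ⊆ Metric.ball y ((l + 1) * r) := by
    intro z hz
    simp only [Set.mem_iUnion, Metric.mem_ball] at hz ⊢
    obtain ⟨i, hi, hz⟩ := hz
    nlinarith [dist_triangle z (x i) y, hs i hi]
  have h1 : s.card * (c * (r / 4) ^ Q) ≤ C * ((l + 1) * r) ^ Q := by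
    calc s.card * (c * (r / 4) ^ Q) = ∑ _i ∈ s, c * (r / 4) ^ Q := by simp
      _ ≤ ∑ i ∈ s, μ.real (Metric.ball (x i) (r / 4)) :=
          Finset.sum_le_sum fun i _ => hlow _ _ (by positivity) (by linarith)
      _ = μ.real (⋃ i ∈ s, Metric.ball (x i) (r / 4)) :=
          (measureReal_biUnion_finset hdisj fun i _ => measurableSet_ball).symm
      _ ≤ μ.real (Metric.ball y ((l + 1) * r)) := measureReal_mono hsub
      _ ≤ C * ((l + 1) * r) ^ Q := hup _ _ (by positivity)
  have h2 : ((l + 1) * r) ^ Q = (4 * (l + 1)) ^ Q * (r / 4) ^ Q := by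
    rw [← Real.mul_rpow (by positivity) (by positivity)]
    congr 1
    ring
  have h3 : 0 < (r / 4) ^ Q := by positivity
  rw [h2] at h1
  rw [div_mul_eq_mul_div, le_div_iff₀ hc]
  refine le_of_mul_le_mul_right ?_ h3
  linarith

/-- A family of sets with bounded overlap has total mass bounded by a multiple of the mass of the
space. -/
theorem sum_measureReal_le_of_overlap {X : Type*} [MeasurableSpace X] {ν : Measure X} [IsFiniteMeasure ν] (s : Finset ℕ)
    (B : ℕ → Set X) (hB : ∀ i ∈ s, MeasurableSet (B i)) {n : ℝ}
    (hn : ∀ (t : Finset ℕ) (y : X), t ⊆ s → (∀ i ∈ t, y ∈ B i) → (t.card : ℝ) ≤ n) :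
    ∑ i ∈ s, ν.real (B i) ≤ n * ν.real Set.univ := by
  classical
  have h1 : ∀ i ∈ s, ν.real (B i) = ∫ y, (B i).indicator 1 y ∂ν := fun i hi =>
    (integral_indicator_one (hB i hi)).symm
  have hint : ∀ i ∈ s, Integrable ((B i).indicator (1 : X → ℝ)) ν := fun i hi =>
    (integrable_const (1 : ℝ)).indicator (hB i hi)
  rw [Finset.sum_congr rfl h1, ← integral_finsetSum _ hint]
  calc ∫ y, ∑ i ∈ s, (B i).indicator (1 : X → ℝ) y ∂ν ≤ ∫ _, n ∂ν := by
        refine integral_mono (integrable_finsetSum _ hint) (integrable_const _) fun y => ?_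
        have : ∑ i ∈ s, (B i).indicator (1 : X → ℝ) y = (s.filter fun i => y ∈ B i).card := by
          simp [Set.indicator_apply]
        simp only [this]
        exact hn _ y (Finset.filter_subset _ _) fun i hi => (Finset.mem_filter.1 hi).2
    _ = n * ν.real Set.univ := by simp [mul_comm]

end Metric

/-! ### Calculus of the energy seminorms -/

section Energy

variable {X : Type*} [MetricSpace X] [MeasurableSpace X] {p : ℝ} {μ : Measure X}

/-- The seminorm `Γ⟨f⟩(A)^{1/p}`. -/
noncomputable def EnergyData.en (S : EnergyData X p μ) (A : Set X) (f : S.F) : ℝ :=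
  (S.Γ f).real A ^ (1 / p)

/-- The function `u` represents the class `g`. -/
def EnergyData.IsRep (S : EnergyData X p μ) (u : X → ℝ) (g : S.F) : Prop :=
  ((g : Lp ℝ (ENNReal.ofReal p) μ) : X → ℝ) =ᵐ[μ] u

variable {S : EnergyData X p μ}

theorem EnergyData.en_nonneg (A : Set X) (f : S.F) : 0 ≤ S.en A f :=
  Real.rpow_nonneg measureReal_nonneg _

theorem EnergyData.en_rpow (hp : 0 < p) (A : Set X) (f : S.F) :
    S.en A f ^ p = (S.Γ f).real A := by
  rw [EnergyData.en, ← Real.rpow_mul measureReal_nonneg, one_div_mul_cancel hp.ne', Real.rpow_one]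

theorem EnergyData.IsRep.add {u v : X → ℝ} {f g : S.F} (hf : S.IsRep u f) (hg : S.IsRep v g) :
    S.IsRep (fun x => u x + v x) (f + g) := by
  have h := Lp.coeFn_add (f : Lp ℝ (ENNReal.ofReal p) μ) (g : Lp ℝ (ENNReal.ofReal p) μ)
  filter_upwards [hf, hg, h] with x h1 h2 h3
  rw [Submodule.coe_add, h3, Pi.add_apply, h1, h2]

theorem EnergyData.IsRep.sub {u v : X → ℝ} {f g : S.F} (hf : S.IsRep u f) (hg : S.IsRep v g) :
    S.IsRep (fun x => u x - v x) (f - g) := by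
  have h := Lp.coeFn_sub (f : Lp ℝ (ENNReal.ofReal p) μ) (g : Lp ℝ (ENNReal.ofReal p) μ)
  filter_upwards [hf, hg, h] with x h1 h2 h3
  rw [AddSubgroupClass.coe_sub, h3, Pi.sub_apply, h1, h2]

theorem EnergyData.IsRep.smul {u : X → ℝ} {f : S.F} (a : ℝ) (hf : S.IsRep u f) :
    S.IsRep (fun x => a * u x) (a • f) := by
  have h := Lp.coeFn_smul a (f : Lp ℝ (ENNReal.ofReal p) μ)
  filter_upwards [hf, h] with x h1 h3
  rw [Submodule.coe_smul, h3, Pi.smul_apply, h1, smul_eq_mul]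

theorem EnergyData.isRep_zero : S.IsRep (fun _ => 0) 0 :=
  Lp.coeFn_zero ℝ (ENNReal.ofReal p) μ

theorem EnergyData.isRep_sum {ι : Type*} (s : Finset ι) {u : ι → X → ℝ} {f : ι → S.F}
    (h : ∀ i ∈ s, S.IsRep (u i) (f i)) :
    S.IsRep (fun x => ∑ i ∈ s, u i x) (∑ i ∈ s, f i) := by
  classical
  induction s using Finset.induction_on with
  | empty => simpa using EnergyData.isRep_zero
  | insert i s hi ih =>
    simp only [Finset.sum_insert hi]
    exact (h i (Finset.mem_insert_self i s)).add
      (ih fun j hj => h j (Finset.mem_insert_of_mem hj))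

variable [BorelSpace X]

theorem IsDirichletSpace.isFiniteMeasure (hS : IsDirichletSpace S) (f : S.F) :
    IsFiniteMeasure (S.Γ f) :=
  ⟨by rw [hS.Γ_univ]; exact ENNReal.coe_lt_top⟩

theorem IsDirichletSpace.en_mono (hS : IsDirichletSpace S) (hp : 0 < p) {A B : Set X}
    (h : A ⊆ B) (f : S.F) : S.en A f ≤ S.en B f := by
  have := hS.isFiniteMeasure f
  exact Real.rpow_le_rpow measureReal_nonneg (measureReal_mono h) (by positivity)

theorem IsDirichletSpace.en_smul (hS : IsDirichletSpace S) (hp : 0 < p) (A : Set X) (a : ℝ)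
    (f : S.F) : S.en A (a • f) = |a| * S.en A f := by
  rw [EnergyData.en, EnergyData.en, hS.Γ_smul, measureReal_ennreal_smul_apply,
    ENNReal.toReal_ofReal (by positivity), Real.mul_rpow (by positivity) measureReal_nonneg,
    ← Real.rpow_mul (abs_nonneg a), mul_one_div_cancel hp.ne', Real.rpow_one]

theorem IsDirichletSpace.en_add_le (hS : IsDirichletSpace S) (hp : 0 < p) {A : Set X}
    (hA : MeasurableSet A) (f g : S.F) : S.en A (f + g) ≤ S.en A f + S.en A g := by
  have := hS.isFiniteMeasure f
  have := hS.isFiniteMeasure g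
  have h := hS.Γ_add_le f g A hA
  have hp' : 0 ≤ 1 / p := by positivity
  have hfin : ∀ k : S.F, (S.Γ k A) ^ (1 / p) ≠ ∞ := fun k =>
    ENNReal.rpow_ne_top_of_nonneg hp' (by have := hS.isFiniteMeasure k; exact measure_ne_top _ _)
  have h' := ENNReal.toReal_mono (ENNReal.add_ne_top.2 ⟨hfin f, hfin g⟩) h
  rw [ENNReal.toReal_add (hfin f) (hfin g), ← ENNReal.toReal_rpow, ← ENNReal.toReal_rpow,
    ← ENNReal.toReal_rpow] at h'
  exact h'

theorem IsDirichletSpace.en_sub_le (hS : IsDirichletSpace S) (hp : 0 < p) {A : Set X}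
    (hA : MeasurableSet A) (f g : S.F) : S.en A (f - g) ≤ S.en A f + S.en A g := by
  have h := hS.en_add_le hp hA f ((-1 : ℝ) • g)
  rw [hS.en_smul hp, abs_neg, abs_one, one_mul] at h
  rwa [sub_eq_add_neg, ← neg_one_smul ℝ g]

theorem IsDirichletSpace.en_zero (hS : IsDirichletSpace S) (hp : 0 < p) (A : Set X) :
    S.en A 0 = 0 := by
  have h := hS.en_smul hp A 0 0
  simpa using h

theorem IsDirichletSpace.en_sum_le (hS : IsDirichletSpace S) (hp : 0 < p) {A : Set X}
    (hA : MeasurableSet A) {ι : Type*} (s : Finset ι) (f : ι → S.F) :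
    S.en A (∑ i ∈ s, f i) ≤ ∑ i ∈ s, S.en A (f i) := by
  classical
  induction s using Finset.induction_on with
  | empty => simp [hS.en_zero hp]
  | insert i s hi ih =>
    rw [Finset.sum_insert hi, Finset.sum_insert hi]
    exact (hS.en_add_le hp hA _ _).trans (by gcongr)

/-- Locality: the energy on an open set only depends on the function there, up to a constant. -/
theorem IsDirichletSpace.en_le_of_eq_on (hS : IsDirichletSpace S) (hp : 0 < p) {A : Set X}
    (hA : IsOpen A) {u v : X → ℝ} {f g : S.F} (hf : S.IsRep u f) (hg : S.IsRep v g) (c : ℝ)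
    (h : ∀ x ∈ A, u x = v x + c) : S.en A f ≤ S.en A g := by
  have h0 : S.Γ (f - g) A = 0 := by
    refine hS.strongly_local (f - g) A hA c ?_
    filter_upwards [hf.sub hg] with x hx hxA
    rw [hx, h x hxA]
    ring
  have h1 : S.en A (f - g) = 0 := by
    rw [EnergyData.en, measureReal_def, h0, ENNReal.toReal_zero, Real.zero_rpow]
    positivity
  have h2 := hS.en_add_le hp hA.measurableSet g (f - g)
  rwa [add_sub_cancel, h1, add_zero] at h2

theorem IsDirichletSpace.exists_isRep_comp (hS : IsDirichletSpace S) (hp : 0 < p) {u : X → ℝ}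
    {f : S.F} (hf : S.IsRep u f) {φ : ℝ → ℝ} (hφ : LipschitzWith 1 φ) (h0 : φ 0 = 0) :
    ∃ g : S.F, S.IsRep (fun x => φ (u x)) g ∧ ∀ A, S.en A g ≤ S.en A f := by
  obtain ⟨h, hle⟩ := hS.lipschitz f φ hφ h0
  refine ⟨⟨_, h⟩, ?_, fun A => ?_⟩
  · have := hφ.coeFn_compLp h0 (f : Lp ℝ (ENNReal.ofReal p) μ)
    filter_upwards [this, hf] with x h1 h2
    rw [h1, Function.comp_apply, h2]
  · have := hS.isFiniteMeasure f
    refine Real.rpow_le_rpow measureReal_nonneg ?_ (by positivity)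
    exact ENNReal.toReal_mono (measure_ne_top _ _) (hle A)

theorem IsDirichletSpace.exists_isRep_posPart (hS : IsDirichletSpace S) (hp : 0 < p) {u : X → ℝ}
    {f : S.F} (hf : S.IsRep u f) :
    ∃ g : S.F, S.IsRep (fun x => max (u x) 0) g ∧ ∀ A, S.en A g ≤ S.en A f :=
  hS.exists_isRep_comp hp hf (LipschitzWith.id.max_const 0) (by simp)

/-- The maximum of finitely many functions of energy at most `b ^ p` and zero. -/
theorem IsDirichletSpace.exists_isRep_fold_max (hS : IsDirichletSpace S) (hp : 0 < p)
    {b : ℝ} (T : Finset ℕ) (φ : ℕ → X → ℝ)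
    (hφ : ∀ i ∈ T, ∃ f : S.F, S.IsRep (φ i) f ∧ S.en Set.univ f ≤ b) :
    ∃ g : S.F, S.IsRep (fun x => T.fold max 0 fun i => φ i x) g ∧
      S.en Set.univ g ≤ 2 * T.card * b := by
  classical
  induction T using Finset.induction_on with
  | empty => exact ⟨0, by simpa using EnergyData.isRep_zero, by simp [hS.en_zero hp]⟩
  | insert i T hi ih =>
    obtain ⟨g, hg, hgb⟩ := ih fun j hj => hφ j (Finset.mem_insert_of_mem hj)
    obtain ⟨f, hf, hfb⟩ := hφ i (Finset.mem_insert_self i T)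
    -- Contractivity concerns one function at a time, so the maximum is written as max(f, g) = f +
    -- (g - f)⁺. Here `f` is counted twice, whence the factor 2.
    obtain ⟨k, hk, hkb⟩ := hS.exists_isRep_posPart hp (hg.sub hf)
    refine ⟨f + k, ?_, ?_⟩
    · have := hf.add hk
      convert this using 2 with x
      rw [Finset.fold_insert hi, ← max_add_add_left, max_comm]
      simp
    · have h1 := hS.en_add_le hp MeasurableSet.univ f k
      have h2 := hS.en_sub_le hp MeasurableSet.univ g f
      have h3 := hkb Set.univ
      rw [Finset.card_insert_of_notMem hi]
      push_cast
      linarith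

end Energy

/-- Two-sided power bounds for the volume of balls. -/
structure VolumeBounds {X : Type*} [MetricSpace X] [MeasurableSpace X] (μ : Measure X)
    (Q c C R : ℝ) : Prop where
  c_pos : 0 < c
  C_pos : 0 < C
  R_pos : 0 < R
  lower : ∀ (x : X) (r : ℝ), 0 < r → r ≤ R → c * r ^ Q ≤ μ.real (Metric.ball x r)
  upper : ∀ (x : X) (r : ℝ), 0 < r → μ.real (Metric.ball x r) ≤ C * r ^ Q

/-! ### Partitions of unity with controlled energy -/

section Partition

/-- The positive part is the increment of the running maximum of the cut-offs, so these functions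
telescope when summed. Where `φ k` is nonzero, cut-offs with centres at distance at least 4r vanish.
Only neighbours need be subtracted, which keeps the energy bound independent of `k`. -/
theorem fold_max_sub_posPart_eq {X : Type*} [MetricSpace X] {r : ℝ} (x : ℕ → X)
    (φ : ℕ → X → ℝ)
    (hφ : ∀ k y, 2 * r ≤ dist y (x k) → φ k y = 0) (k : ℕ) (y : X) :
    max (φ k y - ((Finset.range k).filter fun i => dist (x i) (x k) < 4 * r).fold max 0
      fun i => φ i y) 0 =
    (Finset.range (k + 1)).fold max 0 (fun i => φ i y) -
      (Finset.range k).fold max 0 (fun i => φ i y) := by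
  have hR : (Finset.range (k + 1)).fold max 0 (fun i => φ i y) =
      max (φ k y) ((Finset.range k).fold max 0 fun i => φ i y) := by
    rw [Finset.range_add_one, Finset.fold_insert Finset.notMem_range_self]
  have hn : ∀ T : Finset ℕ, 0 ≤ T.fold max 0 fun i => φ i y := fun T =>
    (Finset.le_fold_max _).2 (Or.inl le_rfl)
  rw [hR]
  rcases le_or_gt (2 * r) (dist y (x k)) with hk | hk
  · rw [hφ k y hk, max_eq_right (hn _), max_eq_right (by linarith [hn ((Finset.range k).filter
      fun i => dist (x i) (x k) < 4 * r)]), sub_self]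
  · have : ((Finset.range k).filter fun i => dist (x i) (x k) < 4 * r).fold max 0
        (fun i => φ i y) = (Finset.range k).fold max 0 fun i => φ i y := by
      apply le_antisymm
      · refine (Finset.fold_max_le _).2 ⟨hn _, fun i hi => ?_⟩
        exact (Finset.le_fold_max _).2 (Or.inr ⟨i, Finset.filter_subset _ _ hi, le_rfl⟩)
      · refine (Finset.fold_max_le _).2 ⟨hn _, fun i hi => ?_⟩
        by_cases hd : dist (x i) (x k) < 4 * r
        · exact (Finset.le_fold_max _).2 (Or.inr ⟨i, Finset.mem_filter.2 ⟨hi, hd⟩, le_rfl⟩)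
        · rw [hφ i y (by
            have := dist_triangle (x i) y (x k)
            rw [dist_comm (x i) y] at this
            linarith [not_lt.1 hd])]
          exact hn _
    rw [this, ← max_sub_sub_right, sub_self]

variable {X : Type*} [MetricSpace X] [MeasurableSpace X] [BorelSpace X] {p β : ℝ}
  {μ : Measure X} {S : EnergyData X p μ}

/-- Cut-off functions with values in `[0, 1]` and controlled energy. -/
theorem IsPoincareDirichletSpace.exists_cutoff (hS : IsPoincareDirichletSpace S β) (hp : 0 < p)
    {Q c C R : ℝ} (hV : VolumeBounds μ Q c C R) :
    ∃ b : ℝ, 0 ≤ b ∧ ∀ (x : X) (r : ℝ), 0 < r → ∃ (φ : X → ℝ) (f : S.F), S.IsRep φ f ∧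
      (∀ y, 0 ≤ φ y) ∧ (∀ y, φ y ≤ 1) ∧ (∀ y, dist y x < r → φ y = 1) ∧
      (∀ y, 2 * r ≤ dist y x → φ y = 0) ∧ S.en Set.univ f ≤ b * r ^ ((Q - β) / p) := by
  obtain ⟨K, hK, hcap⟩ := hS.capacity
  have hC := hV.C_pos
  refine ⟨(K * C) ^ (1 / p), by positivity, fun x r hr => ?_⟩
  obtain ⟨φ, g, -, hrep, h1, h0, hE⟩ := hcap x r hr
  -- Truncation to [0, 1] does not increase the energy.
  have hφ : LipschitzWith 1 fun t : ℝ => max (min t 1) 0 :=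
    (LipschitzWith.id.min_const 1).max_const 0
  obtain ⟨f, hf, hfe⟩ := hS.toIsDirichletSpace.exists_isRep_comp hp (u := φ) hrep hφ (by simp)
  refine ⟨_, f, hf, fun y => le_max_right _ _, fun y => by simp, fun y hy => ?_, fun y hy => ?_, ?_⟩
  · simp [h1 y (Metric.mem_ball.2 hy)]
  · simp [h0 y (by simpa using hy)]
  · refine (hfe Set.univ).trans ?_
    have h2 : (S.Γ g).real Set.univ ≤ K * C * r ^ (Q - β) := by
      rw [measureReal_def, hS.Γ_univ, ENNReal.coe_toReal]
      refine hE.trans ?_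
      calc K * (μ.real (Metric.ball x r) / r ^ β) ≤ K * (C * r ^ Q / r ^ β) := by
            gcongr
            exact hV.upper x r hr
        _ = K * C * r ^ (Q - β) := by rw [Real.rpow_sub hr]; ring
    calc S.en Set.univ g ≤ (K * C * r ^ (Q - β)) ^ (1 / p) :=
          Real.rpow_le_rpow measureReal_nonneg h2 (by positivity)
      _ = (K * C) ^ (1 / p) * r ^ ((Q - β) / p) := by
          rw [Real.mul_rpow (by positivity) (by positivity), ← Real.rpow_mul hr.le, mul_one_div]

/-- Partitions of unity subordinate to nets, with controlled energy. -/
theorem IsPoincareDirichletSpace.exists_partition [IsFiniteMeasure μ]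
    (hS : IsPoincareDirichletSpace S β) (hp : 0 < p)
    {Q c C R : ℝ} (hV : VolumeBounds μ Q c C R) :
    ∃ K : ℝ, 0 ≤ K ∧ ∀ r : ℝ, 0 < r → r ≤ R → ∀ (N : ℕ) (x : ℕ → X),
      (∀ i < N, ∀ j < N, i ≠ j → r / 2 < dist (x i) (x j)) → (∀ y, ∃ i < N, dist y (x i) < r) →
      ∃ (ψ : ℕ → X → ℝ) (h : ℕ → S.F), (∀ k y, 0 ≤ ψ k y) ∧
        (∀ y, ∑ k ∈ Finset.range N, ψ k y = 1) ∧
        (∀ k y, 2 * r ≤ dist y (x k) → ψ k y = 0) ∧ (∀ k, S.IsRep (ψ k) (h k)) ∧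
        ∀ k < N, S.en Set.univ (h k) ≤ K * r ^ ((Q - β) / p) := by
  obtain ⟨b, hb, hcut⟩ := hS.exists_cutoff hp hV
  have hc := hV.c_pos
  have hC := hV.C_pos
  have hD := hS.toIsDirichletSpace
  -- One cut-off energy for `f k`, and two for each of the boundedly many net points within 4r.
  refine ⟨(2 * (C / c * (4 * (4 + 1)) ^ Q) + 1) * b, by positivity, ?_⟩
  intro r hr hrR N x hsep hcov
  choose φ f hrep h0 h1 hone hzero hen using fun k => hcut (x k) r hr
  have hfold := fun k => hD.exists_isRep_fold_max hp (b := b * r ^ ((Q - β) / p))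
    ((Finset.range k).filter fun i => dist (x i) (x k) < 4 * r) φ fun i _ => ⟨f i, hrep i, hen i⟩
  choose g hg hge using hfold
  choose h hh hhe using fun k => hD.exists_isRep_posPart hp ((hrep k).sub (hg k))
  refine ⟨_, h, fun k y => le_max_right _ _, fun y => ?_, fun k y hy => ?_, hh, fun k hk => ?_⟩
  · rw [Finset.sum_congr rfl fun k _ => fold_max_sub_posPart_eq x φ hzero k y,
      Finset.sum_range_sub fun k => (Finset.range k).fold max 0 fun i => φ i y]
    simp only [Finset.range_zero, Finset.fold_empty, sub_zero]
    apply le_antisymm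
    · exact (Finset.fold_max_le _).2 ⟨zero_le_one, fun i _ => h1 i y⟩
    · obtain ⟨i, hi, hy⟩ := hcov y
      exact (Finset.le_fold_max _).2 (Or.inr ⟨i, Finset.mem_range.2 hi, (hone i y hy).ge⟩)
  · have hn : 0 ≤ ((Finset.range k).filter fun i => dist (x i) (x k) < 4 * r).fold max 0
        fun i => φ i y := (Finset.le_fold_max _).2 (Or.inl le_rfl)
    rw [hzero k y hy]
    exact max_eq_right (by linarith)
  · have hcard := card_le_of_separated hc hV.lower hV.upper hr hrR (l := 4) (by norm_num)
      ((Finset.range k).filter fun i => dist (x i) (x k) < 4 * r) x (x k)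
      (fun i hi j hj => hsep i ((Finset.mem_range.1 (Finset.mem_filter.1 hi).1).trans hk) j
        ((Finset.mem_range.1 (Finset.mem_filter.1 hj).1).trans hk))
      (fun i hi => (Finset.mem_filter.1 hi).2)
    have hB : 0 ≤ b * r ^ ((Q - β) / p) := by positivity
    have h2 := hD.en_sub_le hp MeasurableSet.univ (f k) (g k)
    have h3 := mul_le_mul_of_nonneg_right hcard hB
    have h4 := hge k
    have h5 := hen k
    have h6 := hhe k Set.univ
    linarith

end Partition

/-! ### Averages and `p`-th moments -/

section Average

variable {X : Type*} [MeasurableSpace X] {μ : Measure X} [IsFiniteMeasure μ] {p : ℝ}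

omit [IsFiniteMeasure μ] in
theorem integrable_abs_sub_rpow (hp : 0 < p) {f : X → ℝ} (hf : MemLp f (ENNReal.ofReal p) μ)
    {g : X → ℝ} (hg : MemLp g (ENNReal.ofReal p) μ) :
    Integrable (fun x => |f x - g x| ^ p) μ := by
  have h := (hf.sub hg).integrable_norm_rpow (by simpa using hp) ENNReal.ofReal_ne_top
  rwa [ENNReal.toReal_ofReal hp.le] at h

/-- The distance of the average over a smaller set to a constant is controlled by the `p`-th
moment over a larger set. -/
theorem abs_average_sub_rpow_le (hp : 1 ≤ p) {f : X → ℝ} (hf : MemLp f (ENNReal.ofReal p) μ)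
    {A B : Set X} (hAB : A ⊆ B) (hpos : 0 < μ.real A) (a : ℝ) :
    |⨍ x in A, f x ∂μ - a| ^ p ≤ (μ.real A)⁻¹ * ∫ x in B, |f x - a| ^ p ∂μ := by
  have hp0 : 0 < p := by linarith
  have hfi : Integrable f μ := hf.integrable (by simpa using ENNReal.ofReal_le_ofReal hp)
  have hpi := integrable_abs_sub_rpow hp0 hf (memLp_const (μ := μ) (p := ENNReal.ofReal p) a)
  have hA0 : μ A ≠ 0 := fun h => by simp [measureReal_def, h] at hpos
  have hint : Integrable (fun x => |f x - a|) μ := (hfi.sub (integrable_const a)).abs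
  have h1 : |⨍ x in A, f x ∂μ - a| ≤ ⨍ x in A, |f x - a| ∂μ := by
    have : ⨍ x in A, f x ∂μ - a = ⨍ x in A, (f x - a) ∂μ := by
      rw [setAverage_eq, setAverage_eq, integral_sub hfi.integrableOn (integrable_const a),
        setIntegral_const, smul_sub, smul_smul, inv_mul_cancel₀ hpos.ne', one_smul]
    rw [this, setAverage_eq, setAverage_eq, smul_eq_mul, smul_eq_mul, abs_mul,
      abs_of_pos (inv_pos.2 hpos)]
    gcongr
    exact abs_integral_le_integral_abs
  have h2 := (convexOn_rpow hp).map_set_average_le (μ := μ) (t := A) (f := fun x => |f x - a|)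
    (Real.continuous_rpow_const hp0.le).continuousOn isClosed_Ici hA0 (measure_ne_top _ _)
    (Eventually.of_forall fun x => Set.mem_Ici.2 (abs_nonneg _)) hint.integrableOn hpi.integrableOn
  refine (Real.rpow_le_rpow (abs_nonneg _) h1 hp0.le).trans (h2.trans ?_)
  rw [setAverage_eq, smul_eq_mul]
  refine mul_le_mul_of_nonneg_left ?_ (inv_nonneg.2 hpos.le)
  exact setIntegral_mono_set hpi.integrableOn (Eventually.of_forall fun x => by positivity)
    hAB.eventuallyLE

end Average

/-! ### Oscillation of averages along geodesic chains -/

section Poincare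

variable {X : Type*} [MetricSpace X] [MeasurableSpace X] {p β : ℝ}
  {μ : Measure X} [IsFiniteMeasure μ]

/-- Comparison of the averages over nested balls. -/
theorem abs_average_sub_average_rpow_le (hp : 1 ≤ p) {Q c C R : ℝ} (hV : VolumeBounds μ Q c C R)
    {f : X → ℝ} (hf : MemLp f (ENNReal.ofReal p) μ) {ν : Measure X} {P σ : ℝ}
    (hP : ∀ (x : X) (r : ℝ), 0 < r →
      ∫ y in Metric.ball x r, |f y - ⨍ z in Metric.ball x r, f z ∂μ| ^ p ∂μ ≤
        P * r ^ β * ν.real (Metric.ball x (σ * r)))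
    {x y : X} {r s : ℝ} (hs : 0 < s) (hsR : s ≤ R) (hr : dist y x + s ≤ r) :
    |⨍ z in Metric.ball y s, f z ∂μ - ⨍ z in Metric.ball x r, f z ∂μ| ^ p ≤
      (c * s ^ Q)⁻¹ * (P * r ^ β * ν.real (Metric.ball x (σ * r))) := by
  have hc := hV.c_pos
  have hlow := hV.lower y s hs hsR
  have hcs : 0 < c * s ^ Q := by positivity
  have hr0 : 0 < r := by linarith [dist_nonneg (x := y) (y := x)]
  have h0 : 0 ≤ ∫ w in Metric.ball x r, |f w - ⨍ z in Metric.ball x r, f z ∂μ| ^ p ∂μ :=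
    integral_nonneg fun w => by positivity
  refine (abs_average_sub_rpow_le hp hf (Metric.ball_subset_ball' (add_comm s _ ▸ hr))
    (hcs.trans_le hlow) _).trans ?_
  exact mul_le_mul (inv_anti₀ hcs hlow) (hP x r hr0) h0 (by positivity)

/-- Along a geodesic chain whose points are close to a set on which the energy density is
bounded, averages over small balls vary little. -/
theorem abs_average_sub_average_le_of_chain (hgeo : IsGeodesic X) (hp : 1 ≤ p) {Q c C R : ℝ}
    (hV : VolumeBounds μ Q c C R)
    {f : X → ℝ} (hf : MemLp f (ENNReal.ofReal p) μ) {ν : Measure X} {P σ : ℝ} (hP0 : 0 ≤ P)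
    (hσ : 0 < σ)
    (hP : ∀ (x : X) (r : ℝ), 0 < r →
      ∫ y in Metric.ball x r, |f y - ⨍ z in Metric.ball x r, f z ∂μ| ^ p ∂μ ≤
        P * r ^ β * ν.real (Metric.ball x (σ * r)))
    {A : Set X} {M : ℝ}
    (hA : ∀ a ∈ A, ∀ t : ℝ, 0 < t → ν.real (Metric.ball a t) ≤ M * t ^ Q)
    {x y : X} {s : ℝ} (hs : 0 < s) (hsR : s ≤ R) {m : ℕ} (hm : 0 < m) (hxy : dist x y ≤ m * s)
    (hclose : ∀ z, dist x z ≤ dist x y → ∃ a ∈ A, dist z a < 2 * s) :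
    |⨍ z in Metric.ball x s, f z ∂μ - ⨍ z in Metric.ball y s, f z ∂μ| ≤
      m * (2 * (c⁻¹ * P * 4 ^ β * (4 * σ) ^ Q * M * s ^ β) ^ (1 / p)) := by
  have hp0 : 0 < p := by linarith
  have hc := hV.c_pos
  have hm' : (0 : ℝ) < m := by exact_mod_cast hm
  obtain ⟨z, hz0, hzm, hzd, hzs⟩ := hgeo.exists_chain x y hm
  set F : ℕ → ℝ := fun j => ⨍ w in Metric.ball (z j) s, f w ∂μ with hF
  set L := (c⁻¹ * P * 4 ^ β * (4 * σ) ^ Q * M * s ^ β) ^ (1 / p) with hL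
  -- The averages at two consecutive chain points are both compared with the average over B(a, 4s),
  -- where a is a point of `A` within 2s of the first: 2s + s + s = 4s. The volume factor s^{-Q}
  -- cancels against the density bound, leaving s^β.
  have hstep : ∀ w a : X, a ∈ A → dist w a + s ≤ 4 * s →
      |⨍ v in Metric.ball w s, f v ∂μ - ⨍ v in Metric.ball a (4 * s), f v ∂μ| ≤ L := by
    intro w a ha hwa
    have h1 := abs_average_sub_average_rpow_le hp hV hf hP hs hsR hwa
    have h2 := hA a ha (σ * (4 * s)) (by positivity)
    have h3 : (c * s ^ Q)⁻¹ * (P * (4 * s) ^ β * ν.real (Metric.ball a (σ * (4 * s)))) ≤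
        c⁻¹ * P * 4 ^ β * (4 * σ) ^ Q * M * s ^ β := by
      calc _ ≤ (c * s ^ Q)⁻¹ * (P * (4 * s) ^ β * (M * (σ * (4 * s)) ^ Q)) := by gcongr
        _ = _ := by
          have hsQ : s ^ Q ≠ 0 := by positivity
          rw [show σ * (4 * s) = 4 * σ * s by ring, Real.mul_rpow (by positivity) hs.le,
            Real.mul_rpow (by positivity : (0 : ℝ) ≤ 4 * σ) hs.le]
          field_simp
    have h4 := Real.rpow_le_rpow (by positivity) (h1.trans h3) (by positivity : 0 ≤ 1 / p)
    rwa [← Real.rpow_mul (abs_nonneg _), mul_one_div_cancel hp0.ne', Real.rpow_one] at h4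
  have hdiff : ∀ j < m, dist (F j) (F (j + 1)) ≤ 2 * L := by
    intro j hj
    obtain ⟨a, ha, hza⟩ := hclose (z j) (hzd j hj.le)
    have hjj : dist (z (j + 1)) (z j) ≤ s := by
      rw [dist_comm]
      exact (hzs j hj).trans ((div_le_iff₀ hm').2 (by linarith))
    have h1 := hstep (z j) a ha (by linarith)
    have h2 := hstep (z (j + 1)) a ha (by linarith [dist_triangle (z (j + 1)) (z j) a])
    rw [Real.dist_eq]
    rw [abs_sub_comm] at h2
    refine (abs_sub_le _ (⨍ v in Metric.ball a (4 * s), f v ∂μ) _).trans ?_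
    linarith
  have := dist_le_range_sum_of_dist_le (f := F) m (d := fun _ => 2 * L) (fun {k} hk => hdiff k hk)
  rw [Finset.sum_const, Finset.card_range, nsmul_eq_mul, Real.dist_eq] at this
  simpa only [hF, hz0, hzm] using this

end Poincare

/-! ### Discretization at scale r with averages at scale r/n -/

section Discretization

theorem integral_le_sum_of_cover {X : Type*} [MeasurableSpace X] {μ : Measure X} {f : X → ℝ}
    (hf : Integrable f μ) (h0 : ∀ x, 0 ≤ f x) {ι : Type*} (s : Finset ι) (B : ι → Set X)
    (hB : ∀ i ∈ s, MeasurableSet (B i)) (hcov : ∀ x, ∃ i ∈ s, x ∈ B i) :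
    ∫ x, f x ∂μ ≤ ∑ i ∈ s, ∫ x in B i, f x ∂μ := by
  have hint : ∀ i ∈ s, Integrable ((B i).indicator f) μ := fun i hi => hf.indicator (hB i hi)
  rw [← Finset.sum_congr rfl fun i hi => integral_indicator (hB i hi),
    ← integral_finsetSum _ hint]
  refine integral_mono hf (integrable_finsetSum _ hint) fun x => ?_
  obtain ⟨i, hi, hx⟩ := hcov x
  calc f x = (B i).indicator f x := (Set.indicator_of_mem hx f).symm
    _ ≤ ∑ i ∈ s, (B i).indicator f x := Finset.single_le_sum
        (f := fun i => (B i).indicator f x) (fun j _ => Set.indicator_nonneg (fun y _ => h0 y) x) hi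

theorem norm_rpow_eq_integral {X : Type*} [MeasurableSpace X] {μ : Measure X} {p : ℝ} (hp : 0 < p)
    (f : Lp ℝ (ENNReal.ofReal p) μ) : ‖f‖ ^ p = ∫ x, |f x| ^ p ∂μ := by
  have h := (Lp.memLp f).eLpNorm_eq_integral_rpow_norm (by simpa using hp) ENNReal.ofReal_ne_top
  have h0 : 0 ≤ ∫ x, |f x| ^ p ∂μ := integral_nonneg fun x => by positivity
  simp only [ENNReal.toReal_ofReal hp.le, Real.norm_eq_abs] at h
  rw [Lp.norm_def, h, ENNReal.toReal_ofReal (by positivity), ← Real.rpow_mul h0,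
    inv_mul_cancel₀ hp.ne', Real.rpow_one]

theorem add_rpow_le_two_rpow_mul {p a b : ℝ} (hp : 0 < p) (ha : 0 ≤ a) (hb : 0 ≤ b) :
    (a + b) ^ p ≤ 2 ^ p * (a ^ p + b ^ p) := by
  have h1 : (a + b) ^ p ≤ (2 * max a b) ^ p :=
    Real.rpow_le_rpow (by positivity) (by linarith [le_max_left a b, le_max_right a b]) hp.le
  rw [Real.mul_rpow (by norm_num) (by positivity)] at h1
  refine h1.trans ?_
  gcongr
  rcases max_choice a b with h | h <;> rw [h]
  · linarith [Real.rpow_nonneg hb p]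
  · linarith [Real.rpow_nonneg ha p]

variable {X : Type*} [MetricSpace X] [MeasurableSpace X] [BorelSpace X] {p β : ℝ}
  {μ : Measure X} {S : EnergyData X p μ}

omit [MeasurableSpace X] [BorelSpace X] in
/-- Near the `i`-th net point, a combination of the partition functions only involves the
coefficients of neighbouring points. -/
theorem sum_mul_eq_on_ball {r : ℝ} {N : ℕ} {x : ℕ → X} {ψ : ℕ → X → ℝ}
    (hsum : ∀ y, ∑ k ∈ Finset.range N, ψ k y = 1)
    (hzero : ∀ k y, 2 * r ≤ dist y (x k) → ψ k y = 0) (a : ℕ → ℝ) (m : ℝ) (i : ℕ) {y : X}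
    (hy : y ∈ Metric.ball (x i) r) :
    ∑ k ∈ Finset.range N, a k * ψ k y =
      ∑ k ∈ (Finset.range N).filter (fun k => dist (x k) (x i) < 4 * r), (a k - m) * ψ k y + m := by
  have h1 : ∑ k ∈ (Finset.range N).filter (fun k => dist (x k) (x i) < 4 * r),
      (a k - m) * ψ k y = ∑ k ∈ Finset.range N, (a k - m) * ψ k y := by
    refine Finset.sum_subset (Finset.filter_subset _ _) fun k hk hk' => ?_
    have hd : 4 * r ≤ dist (x k) (x i) := by
      by_contra hd
      exact hk' (Finset.mem_filter.2 ⟨hk, not_le.1 hd⟩)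
    have hyr := Metric.mem_ball.1 hy
    have hr0 : 0 < r := dist_nonneg.trans_lt hyr
    rw [hzero k y (by
      have := dist_triangle_left (x k) (x i) y
      linarith), mul_zero]
  rw [h1]
  simp only [sub_mul, Finset.sum_sub_distrib, ← Finset.mul_sum, hsum]
  ring

/-- The local energy of a combination of partition functions is controlled by the local
oscillation of the coefficients. -/
theorem IsDirichletSpace.local_energy_le (hS : IsDirichletSpace S) (hp : 0 < p)
    {r n K : ℝ} {N : ℕ} {x : ℕ → X} {ψ : ℕ → X → ℝ} {h : ℕ → S.F}
    (hsum : ∀ y, ∑ k ∈ Finset.range N, ψ k y = 1)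
    (hzero : ∀ k y, 2 * r ≤ dist y (x k) → ψ k y = 0)
    (hrep : ∀ k, S.IsRep (ψ k) (h k)) (hK : 0 ≤ K)
    (hen : ∀ k < N, S.en Set.univ (h k) ≤ K) (a : ℕ → ℝ) (m : ℝ) (i : ℕ)
    (hn : (((Finset.range N).filter fun k => dist (x k) (x i) < 4 * r).card : ℝ) ≤ n)
    {L : ℝ} (hL0 : 0 ≤ L) (hL : ∀ k < N, dist (x k) (x i) < 4 * r → |a k - m| ≤ L) :
    (S.Γ (∑ k ∈ Finset.range N, a k • h k)).real (Metric.ball (x i) r) ≤ (n * (L * K)) ^ p := by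
  have h1 := hS.en_le_of_eq_on hp (Metric.isOpen_ball (x := x i) (ε := r))
    (EnergyData.isRep_sum (Finset.range N) fun k _ => (hrep k).smul (a k))
    (EnergyData.isRep_sum ((Finset.range N).filter fun k => dist (x k) (x i) < 4 * r)
      fun k _ => (hrep k).smul (a k - m)) m
    (fun y hy => sum_mul_eq_on_ball hsum hzero a m i hy)
  have h2 := hS.en_sum_le hp (measurableSet_ball (x := x i) (ε := r))
    ((Finset.range N).filter fun k => dist (x k) (x i) < 4 * r) fun k => (a k - m) • h k
  have h3 : ∀ k ∈ (Finset.range N).filter (fun k => dist (x k) (x i) < 4 * r),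
      S.en (Metric.ball (x i) r) ((a k - m) • h k) ≤ L * K := by
    intro k hk
    obtain ⟨hk, hd⟩ := Finset.mem_filter.1 hk
    rw [hS.en_smul hp]
    exact mul_le_mul (hL k (Finset.mem_range.1 hk) hd)
      ((hS.en_mono hp (Set.subset_univ _) _).trans (hen k (Finset.mem_range.1 hk)))
      (EnergyData.en_nonneg _ _) hL0
  have h4 := Finset.sum_le_card_nsmul _ _ _ h3
  rw [nsmul_eq_mul] at h4
  have h5 := mul_le_mul_of_nonneg_right hn (mul_nonneg hL0 hK)
  rw [← EnergyData.en_rpow hp]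
  exact Real.rpow_le_rpow (EnergyData.en_nonneg _ _) (by linarith) hp.le

/-- Discretization of a function `f` of finite energy at scale `r`: the approximations converge
to `f`, have bounded energy, and their energy is small on sets near which the energy
density of `f` is bounded on a sufficiently dense set. -/
theorem IsPoincareDirichletSpace.exists_discretization [CompactSpace X] [Nonempty X]
    [IsFiniteMeasure μ] (hS : IsPoincareDirichletSpace S β) (hgeo : IsGeodesic X) (hp : 1 ≤ p)
    {Q c C R : ℝ} (hQ : 0 ≤ Q) (hV : VolumeBounds μ Q c C R) (f : S.F) :
    ∃ K : ℝ, 0 ≤ K ∧ ∀ n : ℕ, 0 < n → ∃ J : ℝ, 0 ≤ J ∧ ∀ r : ℝ, 0 < r → r ≤ R → ∃ g : S.F,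
      ‖(g : Lp ℝ (ENNReal.ofReal p) μ) - f‖ ^ p ≤ J * r ^ β ∧ (S.Γ g).real Set.univ ≤ J ∧
      ∀ (A D : Set X) (M : ℝ), 0 ≤ M →
        (∀ a ∈ A, ∀ t : ℝ, 0 < t → (S.Γ f).real (Metric.ball a t) ≤ M * t ^ Q) →
        (∀ y ∈ D, ∀ z ∈ Metric.ball y (6 * r), ∃ a ∈ A, dist z a < 2 * (r / n)) →
        (S.Γ g).real D ≤ K * M * (n : ℝ) ^ (p - β) := by
  have hp0 : 0 < p := by linarith
  have hD := hS.toIsDirichletSpace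
  have hc := hV.c_pos
  have hC := hV.C_pos
  have hR := hV.R_pos
  have hfin := fun g : S.F => hD.isFiniteMeasure g
  obtain ⟨b, hb, hpart⟩ := hS.exists_partition hp0 hV
  obtain ⟨P, σ, hP1, hσ1, hPoin⟩ := hS.poincare
  have hP0 : 0 ≤ P := by linarith
  have hσ0 : 0 < σ := by linarith
  have hfLp := Lp.memLp (f : Lp ℝ (ENNReal.ofReal p) μ)
  have hPf := fun x r hr => hPoin x r hr f
  set F : X → ℝ := ((f : Lp ℝ (ENNReal.ofReal p) μ) : X → ℝ) with hF
  -- `n₀` bounds the number of net points within 4r, `n₁` the overlap of the balls B(x_i, 6σr), and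
  -- `n₂` the number of net points times r^Q.
  set n₀ : ℝ := C / c * (4 * (4 + 1)) ^ Q with hn₀
  set n₁ : ℝ := C / c * (4 * (6 * σ + 1)) ^ Q with hn₁
  set d : ℝ := Metric.diam (Set.univ : Set X) with hd
  have hd0 : 0 ≤ d := Metric.diam_nonneg
  set n₂ : ℝ := C / c * (4 * (d + 1 + R)) ^ Q with hn₂
  set E : ℝ := (S.Γ f).real Set.univ with hE
  have hE0 : 0 ≤ E := measureReal_nonneg
  set H : ℝ := c⁻¹ * P * 4 ^ β * (4 * σ) ^ Q with hH
  have hH0 : 0 ≤ H := by positivity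
  refine ⟨n₂ * ((n₀ * b * 8) ^ p * H), by positivity, fun n hn => ?_⟩
  have hn' : (0 : ℝ) < n := by exact_mod_cast hn
  have hn1 : (1 : ℝ) ≤ n := by exact_mod_cast hn
  -- The factor n^Q is the price of averaging over balls of radius r/n inside balls of radius 6r. It
  -- is harmless, since n stays fixed while r → 0.
  set J₁ : ℝ := 2 ^ p * (P * 6 ^ β * (1 + C * (n : ℝ) ^ Q / c)) * (n₁ * E) with hJ₁
  set J₂ : ℝ := (n₀ * b) ^ p * (P * 6 ^ β * (n : ℝ) ^ Q / c) * (n₁ * E) with hJ₂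
  refine ⟨max J₁ J₂, le_max_of_le_left (by positivity), fun r hr hrR => ?_⟩
  obtain ⟨N, x, hsep, hcov⟩ := exists_net (X := X) hr
  obtain ⟨ψ, h, hψ0, hsum, hzero, hrep, hen⟩ := hpart r hr hrR N x hsep hcov
  set s : ℝ := r / n with hs
  have hs0 : 0 < s := by positivity
  have hsr : s ≤ r := div_le_self hr.le hn1
  have hsR : s ≤ R := hsr.trans hrR
  set a : ℕ → ℝ := fun k => ⨍ z in Metric.ball (x k) s, F z ∂μ with ha
  set G : ℕ → ℝ := fun i => (S.Γ f).real (Metric.ball (x i) (σ * (6 * r))) with hG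
  have hG0 : ∀ i, 0 ≤ G i := fun i => measureReal_nonneg
  set m : ℕ → ℝ := fun i => ⨍ z in Metric.ball (x i) (6 * r), F z ∂μ with hm
  set g : S.F := ∑ k ∈ Finset.range N, a k • h k with hg
  have hcard : ∀ i, (((Finset.range N).filter fun k => dist (x k) (x i) < 4 * r).card : ℝ) ≤ n₀ :=
    fun i => card_le_of_separated hc hV.lower hV.upper hr hrR (by norm_num) _ x (x i)
      (fun k hk j hj => hsep k (Finset.mem_range.1 (Finset.mem_filter.1 hk).1) j
        (Finset.mem_range.1 (Finset.mem_filter.1 hj).1)) fun k hk => (Finset.mem_filter.1 hk).2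
  have hbr : 0 ≤ b * r ^ ((Q - β) / p) := by positivity
  have hrp : (r ^ ((Q - β) / p)) ^ p = r ^ (Q - β) := by
    rw [← Real.rpow_mul hr.le, div_mul_cancel₀ _ hp0.ne']
  -- Used with reference value `m i` and the plain Poincaré oscillation for the global energy bound,
  -- and with `a i` and the chain estimate for the energy on `D`.
  have hloc : ∀ (i : ℕ) (c' L : ℝ), 0 ≤ L →
      (∀ k < N, dist (x k) (x i) < 4 * r → |a k - c'| ≤ L) →
      (S.Γ g).real (Metric.ball (x i) r) ≤ (n₀ * b) ^ p * L ^ p * r ^ (Q - β) := by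
    intro i c' L hL0 hL
    have := hD.local_energy_le hp0 hsum hzero hrep hbr hen a c' i (hcard i) hL0 hL
    refine this.trans_eq ?_
    rw [show n₀ * (L * (b * r ^ ((Q - β) / p))) = n₀ * b * L * r ^ ((Q - β) / p) by ring,
      Real.mul_rpow (by positivity) (by positivity), hrp,
      Real.mul_rpow (by positivity) hL0]
  have hosc : ∀ i, ∀ k, dist (x k) (x i) < 4 * r →
      |a k - m i| ^ p ≤ (c * s ^ Q)⁻¹ * (P * (6 * r) ^ β * G i) := fun i k hk =>
    abs_average_sub_average_rpow_le hp hV hfLp hPf hs0 hsR (by linarith)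
  have hsQ : s ^ Q = r ^ Q / (n : ℝ) ^ Q := Real.div_rpow hr.le hn'.le Q
  have hrQ : r ^ Q ≠ 0 := by positivity
  have hnQ : (n : ℝ) ^ Q ≠ 0 := by positivity
  have hrβ : r ^ β ≠ 0 := by positivity
  have h6 : (6 * r) ^ β = 6 ^ β * r ^ β := Real.mul_rpow (by norm_num) hr.le
  set W : ℕ → ℝ := fun i => (c * s ^ Q)⁻¹ * (P * (6 * r) ^ β * G i) with hW
  have hW0 : ∀ i, 0 ≤ W i := fun i => by have := hG0 i; positivity
  have hosc' : ∀ i, ∀ k < N, dist (x k) (x i) < 4 * r → |a k - m i| ≤ W i ^ (1 / p) := by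
    intro i k _ hk
    have := Real.rpow_le_rpow (by positivity) (hosc i k hk) (by positivity : 0 ≤ 1 / p)
    rwa [← Real.rpow_mul (abs_nonneg _), mul_one_div_cancel hp0.ne', Real.rpow_one] at this
  have hWp : ∀ i, (W i ^ (1 / p)) ^ p = W i := fun i => by
    rw [← Real.rpow_mul (hW0 i), one_div_mul_cancel hp0.ne', Real.rpow_one]
  have hsumG : ∑ i ∈ Finset.range N, G i ≤ n₁ * E := by
    refine sum_measureReal_le_of_overlap _ _ (fun i _ => measurableSet_ball) fun t y ht hty => ?_
    refine card_le_of_separated hc hV.lower hV.upper hr hrR (by positivity) t x y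
      (fun k hk j hj => hsep k (Finset.mem_range.1 (ht hk)) j (Finset.mem_range.1 (ht hj)))
      fun i hi => ?_
    have := Metric.mem_ball'.1 (hty i hi)
    linarith
  have hcov' : ∀ y : X, ∃ i ∈ Finset.range N, y ∈ Metric.ball (x i) r := fun y => by
    obtain ⟨i, hi, hy⟩ := hcov y
    exact ⟨i, Finset.mem_range.2 hi, hy⟩
  refine ⟨g, ?_, ?_, ?_⟩
  · have hu : S.IsRep (fun y => ∑ k ∈ Finset.range N, a k * ψ k y) g :=
      EnergyData.isRep_sum (Finset.range N) fun k _ => (hrep k).smul (a k)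
    set u : X → ℝ := fun y => ∑ k ∈ Finset.range N, a k * ψ k y with hudef
    have huLp : MemLp u (ENNReal.ofReal p) μ :=
      (memLp_congr_ae hu).1 (Lp.memLp (g : Lp ℝ (ENNReal.ofReal p) μ))
    have hnorm : ‖(g : Lp ℝ (ENNReal.ofReal p) μ) - f‖ ^ p = ∫ y, |u y - F y| ^ p ∂μ := by
      rw [norm_rpow_eq_integral hp0]
      refine integral_congr_ae ?_
      filter_upwards [hu, Lp.coeFn_sub (g : Lp ℝ (ENNReal.ofReal p) μ) f] with y h1 h2
      rw [h2, Pi.sub_apply, h1]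
    have hpw : ∀ i, ∀ y ∈ Metric.ball (x i) r,
        |u y - F y| ^ p ≤ 2 ^ p * (|F y - m i| ^ p + W i) := by
      intro i y hy
      have h1 : |u y - m i| ≤ W i ^ (1 / p) := by
        have h2 := sum_mul_eq_on_ball hsum hzero a (m i) i hy
        have h3 : u y - m i = ∑ k ∈ (Finset.range N).filter
            (fun k => dist (x k) (x i) < 4 * r), (a k - m i) * ψ k y := by
          rw [hudef]
          simp only [h2]
          ring
        rw [h3]
        refine (Finset.abs_sum_le_sum_abs _ _).trans ?_
        calc _ ≤ ∑ k ∈ (Finset.range N).filter (fun k => dist (x k) (x i) < 4 * r),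
              W i ^ (1 / p) * ψ k y := by
              refine Finset.sum_le_sum fun k hk => ?_
              obtain ⟨hk, hkd⟩ := Finset.mem_filter.1 hk
              rw [abs_mul, abs_of_nonneg (hψ0 k y)]
              exact mul_le_mul_of_nonneg_right (hosc' i k (Finset.mem_range.1 hk) hkd) (hψ0 k y)
          _ ≤ ∑ k ∈ Finset.range N, W i ^ (1 / p) * ψ k y :=
              Finset.sum_le_sum_of_subset_of_nonneg (Finset.filter_subset _ _) fun k _ _ =>
                mul_nonneg (Real.rpow_nonneg (hW0 i) _) (hψ0 k y)
          _ = W i ^ (1 / p) := by rw [← Finset.mul_sum, hsum, mul_one]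
      have h4 : |u y - F y| ≤ |F y - m i| + W i ^ (1 / p) := by
        have := abs_sub_le (u y) (m i) (F y)
        rw [abs_sub_comm (m i)] at this
        linarith
      refine (Real.rpow_le_rpow (abs_nonneg _) h4 hp0.le).trans ?_
      have h5 := add_rpow_le_two_rpow_mul hp0 (abs_nonneg (F y - m i))
        (Real.rpow_nonneg (hW0 i) (1 / p))
      rwa [hWp] at h5
    have hint := integrable_abs_sub_rpow hp0 huLp hfLp
    have hball : ∀ i, ∫ y in Metric.ball (x i) r, |u y - F y| ^ p ∂μ ≤
        2 ^ p * (P * 6 ^ β * (1 + C * (n : ℝ) ^ Q / c)) * r ^ β * G i := by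
      intro i
      have hint2 := integrable_abs_sub_rpow hp0 hfLp
        (memLp_const (μ := μ) (p := ENNReal.ofReal p) (m i))
      calc ∫ y in Metric.ball (x i) r, |u y - F y| ^ p ∂μ
          ≤ ∫ y in Metric.ball (x i) r, 2 ^ p * (|F y - m i| ^ p + W i) ∂μ :=
            setIntegral_mono_on hint.integrableOn
              ((hint2.add (integrable_const _)).const_mul _).integrableOn measurableSet_ball (hpw i)
        _ = 2 ^ p * (∫ y in Metric.ball (x i) r, |F y - m i| ^ p ∂μ +
              μ.real (Metric.ball (x i) r) * W i) := by
            rw [integral_const_mul, integral_add hint2.integrableOn (integrable_const _),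
              setIntegral_const, smul_eq_mul]
        _ ≤ 2 ^ p * (P * (6 * r) ^ β * G i + C * r ^ Q * W i) := by
            have h1 : ∫ y in Metric.ball (x i) r, |F y - m i| ^ p ∂μ ≤
                ∫ y in Metric.ball (x i) (6 * r), |F y - m i| ^ p ∂μ :=
              setIntegral_mono_set hint2.integrableOn
                (Eventually.of_forall fun y => by positivity)
                (Metric.ball_subset_ball (by linarith)).eventuallyLE
            have h2 := hPf (x i) (6 * r) (by positivity)
            have h3 := mul_le_mul_of_nonneg_right (hV.upper (x i) r hr) (hW0 i)
            gcongr
            exact h1.trans h2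
        _ = _ := by
            rw [hW, h6, hsQ]
            field_simp
    rw [hnorm]
    calc ∫ y, |u y - F y| ^ p ∂μ
        ≤ ∑ i ∈ Finset.range N, ∫ y in Metric.ball (x i) r, |u y - F y| ^ p ∂μ :=
          integral_le_sum_of_cover hint (fun y => by positivity) _ _
            (fun i _ => measurableSet_ball) hcov'
      _ ≤ ∑ i ∈ Finset.range N,
            2 ^ p * (P * 6 ^ β * (1 + C * (n : ℝ) ^ Q / c)) * r ^ β * G i :=
          Finset.sum_le_sum fun i _ => hball i
      _ ≤ 2 ^ p * (P * 6 ^ β * (1 + C * (n : ℝ) ^ Q / c)) * r ^ β * (n₁ * E) := by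
          rw [← Finset.mul_sum]
          gcongr
      _ = J₁ * r ^ β := by rw [hJ₁]; ring
      _ ≤ max J₁ J₂ * r ^ β := by
          gcongr
          exact le_max_left _ _
  · have hunion : Set.univ ⊆ ⋃ i ∈ Finset.range N, Metric.ball (x i) r := fun y _ => by
      obtain ⟨i, hi, hy⟩ := hcov' y
      exact Set.mem_biUnion hi hy
    have := hfin g
    calc (S.Γ g).real Set.univ ≤ (S.Γ g).real (⋃ i ∈ Finset.range N, Metric.ball (x i) r) :=
          measureReal_mono hunion (measure_ne_top _ _)
      _ ≤ ∑ i ∈ Finset.range N, (S.Γ g).real (Metric.ball (x i) r) :=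
          measureReal_biUnion_finset_le _ _
      _ ≤ ∑ i ∈ Finset.range N, (n₀ * b) ^ p * (P * 6 ^ β * (n : ℝ) ^ Q / c) * G i := by
          refine Finset.sum_le_sum fun i _ => ?_
          refine (hloc i (m i) _ (Real.rpow_nonneg (hW0 i) _) (hosc' i)).trans_eq ?_
          rw [hWp, hW, h6, hsQ, Real.rpow_sub hr]
          field_simp
      _ ≤ J₂ := by
          rw [← Finset.mul_sum, hJ₂]
          gcongr
      _ ≤ max J₁ J₂ := le_max_right _ _
  · intro A D M hM hA hAD
    classical
    set T := (Finset.range N).filter fun i => (Metric.ball (x i) r ∩ D).Nonempty with hT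
    have hunion : D ⊆ ⋃ i ∈ T, Metric.ball (x i) r := fun y hyD => by
      obtain ⟨i, hi, hy⟩ := hcov' y
      exact Set.mem_biUnion (Finset.mem_filter.2 ⟨hi, y, hy, hyD⟩) hy
    have := hfin g
    have hcardT : (T.card : ℝ) * r ^ Q ≤ n₂ := by
      have h1 := card_le_of_separated hc hV.lower hV.upper hr hrR (l := (d + 1) / r)
        (by positivity) T x (x 0)
        (fun k hk j hj => hsep k (Finset.mem_range.1 (Finset.mem_filter.1 hk).1) j
          (Finset.mem_range.1 (Finset.mem_filter.1 hj).1)) fun k hk => by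
            rw [div_mul_cancel₀ _ hr.ne']
            have := Metric.dist_le_diam_of_mem (isCompact_univ (X := X)).isBounded
              (Set.mem_univ (x k)) (Set.mem_univ (x 0))
            linarith
      calc (T.card : ℝ) * r ^ Q ≤ C / c * (4 * ((d + 1) / r + 1)) ^ Q * r ^ Q := by gcongr
        _ = C / c * (4 * (d + 1 + r)) ^ Q := by
            rw [mul_assoc, ← Real.mul_rpow (by positivity) hr.le]
            congr 2
            field_simp
        _ ≤ n₂ := by
            rw [hn₂]
            gcongr
    have hL0 : 0 ≤ H * M * s ^ β := by positivity
    calc (S.Γ g).real D ≤ (S.Γ g).real (⋃ i ∈ T, Metric.ball (x i) r) := measureReal_mono hunion (measure_ne_top _ _)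
      _ ≤ ∑ i ∈ T, (S.Γ g).real (Metric.ball (x i) r) := measureReal_biUnion_finset_le _ _
      _ ≤ ∑ i ∈ T, (n₀ * b * 8) ^ p * H * M * (n : ℝ) ^ (p - β) * r ^ Q := by
          refine Finset.sum_le_sum fun i hi => ?_
          obtain ⟨hi, y, hyB, hyD⟩ := Finset.mem_filter.1 hi
          have hyB' := Metric.mem_ball.1 hyB
          -- Neighbours at distance below 4r are joined by 4n steps of length at most s = r/n, each
          -- costing two comparisons. The chain stays within 4r of `x i`, hence within 6r of `y`.
          -- The p-th power gives n^p, and s^β gives n^{-β}.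
          refine (hloc i (a i) (8 * n * (H * M * s ^ β) ^ (1 / p)) (by positivity)
            fun k hk hki => ?_).trans_eq ?_
          · have hdist : dist (x k) (x i) ≤ (4 * n : ℕ) * s := by
              rw [hs]
              push_cast
              rw [mul_assoc, mul_div_cancel₀ _ hn'.ne']
              exact hki.le
            have := abs_average_sub_average_le_of_chain hgeo hp hV hfLp hP0 hσ0 hPf hA hs0 hsR
              (m := 4 * n) (by positivity) (x := x i) (y := x k) (by rwa [dist_comm])
              fun z hz => hAD y hyD z (by
                rw [Metric.mem_ball]
                have h1 := dist_triangle z (x i) y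
                linarith [dist_comm z (x i), dist_comm (x i) y, dist_comm (x i) (x k)])
            rw [abs_sub_comm]
            refine this.trans_eq ?_
            push_cast
            ring
          · have h8 : (8 * n * (H * M * s ^ β) ^ (1 / p)) ^ p = 8 ^ p * (n : ℝ) ^ p *
                (H * M * s ^ β) := by
              rw [Real.mul_rpow (by positivity) (by positivity), ← Real.rpow_mul hL0,
                one_div_mul_cancel hp0.ne', Real.rpow_one, Real.mul_rpow (by norm_num) hn'.le]
            rw [h8, Real.mul_rpow (by positivity : 0 ≤ n₀ * b) (by norm_num : (0 : ℝ) ≤ 8), hs,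
              Real.div_rpow hr.le hn'.le, Real.rpow_sub hr, Real.rpow_sub hn']
            field_simp
      _ = T.card * r ^ Q * ((n₀ * b * 8) ^ p * H * M * (n : ℝ) ^ (p - β)) := by
          rw [Finset.sum_const, nsmul_eq_mul]
          ring
      _ ≤ n₂ * ((n₀ * b * 8) ^ p * H * M * (n : ℝ) ^ (p - β)) := by gcongr
      _ = _ := by ring

end Discretization

/-! ### Differentiation of measures and density points -/

section Density

variable {X : Type*} [MetricSpace X] [MeasurableSpace X] [BorelSpace X]
  {μ : Measure X} [IsFiniteMeasure μ] {Q c C R : ℝ}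

omit [BorelSpace X] in
theorem VolumeBounds.closedBall_le (hV : VolumeBounds μ Q c C R) (x : X) {r t : ℝ}
    (hr : 0 ≤ r) (hrt : r < t) : μ.real (Metric.closedBall x r) ≤ C * t ^ Q :=
  (measureReal_mono (Metric.closedBall_subset_ball hrt)).trans (hV.upper x t (hr.trans_lt hrt))

omit [BorelSpace X] in
theorem VolumeBounds.le_closedBall (hV : VolumeBounds μ Q c C R) (x : X) {r : ℝ}
    (hr : 0 < r) (hrR : r ≤ R) : c * r ^ Q ≤ μ.real (Metric.closedBall x r) :=
  (hV.lower x r hr hrR).trans (measureReal_mono Metric.ball_subset_closedBall)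

omit [BorelSpace X] in
-- This opens the way to differentiation along closed balls. Closed balls of radius 2r are enlarged
-- to open balls of radius 3r, where the upper volume bound applies.
theorem VolumeBounds.isUnifLocDoublingMeasure (hV : VolumeBounds μ Q c C R) :
    IsUnifLocDoublingMeasure μ := by
  have hc := hV.c_pos
  have hC := hV.C_pos
  refine ⟨⟨(C * 3 ^ Q / c).toNNReal, ?_⟩⟩
  filter_upwards [Ioc_mem_nhdsGT hV.R_pos] with r hr x
  have h0 : 0 ≤ C * 3 ^ Q / c := by positivity
  have h1 := hV.closedBall_le x (r := 2 * r) (t := 3 * r) (by linarith [hr.1])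
    (by linarith [hr.1])
  have h2 := hV.le_closedBall x hr.1 hr.2
  have h3 : μ.real (Metric.closedBall x (2 * r)) ≤
      C * 3 ^ Q / c * μ.real (Metric.closedBall x r) := by
    calc _ ≤ C * (3 * r) ^ Q := h1
      _ = C * 3 ^ Q / c * (c * r ^ Q) := by
        rw [Real.mul_rpow (by norm_num) hr.1.le]
        field_simp
      _ ≤ _ := by gcongr
  have h4 := ENNReal.ofReal_le_ofReal h3
  rwa [ENNReal.ofReal_mul h0, ofReal_measureReal, ofReal_measureReal] at h4

/-- Almost everywhere the upper density of a finite measure is finite. -/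
theorem VolumeBounds.ae_exists_density_bound [CompactSpace X] (hV : VolumeBounds μ Q c C R)
    (hQ : 0 ≤ Q) (ν : Measure X) [IsFiniteMeasure ν] :
    ∀ᵐ x ∂μ, ∃ M : ℕ, ∀ t : ℝ, 0 < t → ν.real (Metric.ball x t) ≤ M * t ^ Q := by
  have := hV.isUnifLocDoublingMeasure
  have hC := hV.C_pos
  filter_upwards [(IsUnifLocDoublingMeasure.vitaliFamily μ 1).ae_tendsto_rnDeriv ν,
    Measure.rnDeriv_lt_top ν μ] with x hx hlt
  have h1 := hx.comp (IsUnifLocDoublingMeasure.tendsto_closedBall_filterAt μ (K := 1)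
    (l := 𝓝[>] (0 : ℝ)) (fun _ => x) id tendsto_id (by
      filter_upwards [self_mem_nhdsWithin] with r hr
      simpa using (le_of_lt hr : (0 : ℝ) ≤ r)))
  obtain ⟨L, hL, hL'⟩ := ENNReal.lt_iff_exists_nnreal_btwn.1 hlt
  obtain ⟨t₀, ht₀, hsub⟩ := mem_nhdsGT_iff_exists_Ioc_subset.1 (h1.eventually_lt_const hL)
  have ht₀' : 0 < t₀ := ht₀
  -- The first term serves radii up to `t₀`, by the finite derivative; the second serves larger
  -- radii, by the total mass.
  obtain ⟨M, hM⟩ := exists_nat_ge (max (L * C * 2 ^ Q) (ν.real Set.univ / t₀ ^ Q))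
  refine ⟨M, fun t ht => ?_⟩
  rcases le_or_gt t t₀ with htt | htt
  · have h2 : ν (Metric.closedBall x t) / μ (Metric.closedBall x t) < L := hsub ⟨ht, htt⟩
    have h3 : ν (Metric.closedBall x t) ≤ L * μ (Metric.closedBall x t) :=
      (ENNReal.div_le_iff_le_mul (Or.inr ENNReal.coe_ne_top)
        (Or.inl (measure_ne_top _ _))).1 h2.le
    have h4 := ENNReal.toReal_mono (ENNReal.mul_ne_top ENNReal.coe_ne_top (measure_ne_top _ _)) h3
    rw [ENNReal.toReal_mul, ENNReal.coe_toReal] at h4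
    have h5 := hV.closedBall_le x ht.le (by linarith : t < 2 * t)
    calc ν.real (Metric.ball x t) ≤ ν.real (Metric.closedBall x t) :=
          measureReal_mono Metric.ball_subset_closedBall
      _ ≤ L * μ.real (Metric.closedBall x t) := h4
      _ ≤ L * (C * (2 * t) ^ Q) := by gcongr
      _ = L * C * 2 ^ Q * t ^ Q := by rw [Real.mul_rpow (by norm_num) ht.le]; ring
      _ ≤ M * t ^ Q := by
          gcongr
          exact (le_max_left _ _).trans hM
  · calc ν.real (Metric.ball x t) ≤ ν.real Set.univ := measureReal_mono (Set.subset_univ _)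
      _ = ν.real Set.univ / t₀ ^ Q * t₀ ^ Q := by
          rw [div_mul_cancel₀]
          positivity
      _ ≤ M * t ^ Q := by
          have h6 := (le_max_right _ _).trans hM
          gcongr

omit [BorelSpace X] in
-- By continuity from below, the mass of an open ball of fixed radius is lower semicontinuous in the
-- centre.
theorem isClosed_density_bound {ν : Measure X} [IsFiniteMeasure ν] (M Q : ℝ) :
    IsClosed {x : X | ∀ t : ℝ, 0 < t → ν.real (Metric.ball x t) ≤ M * t ^ Q} := by
  rw [← isOpen_compl_iff, Metric.isOpen_iff]
  intro x hx
  simp only [Set.mem_compl_iff, Set.mem_ofPred_eq, not_forall, not_le] at hx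
  obtain ⟨t, ht, hxt⟩ := hx
  have hU : Metric.ball x t = ⋃ n : ℕ, Metric.ball x (t - 1 / ((n : ℝ) + 1)) := by
    ext y
    simp only [Metric.mem_ball, Set.mem_iUnion]
    constructor
    · intro hy
      obtain ⟨n, hn⟩ := exists_nat_one_div_lt (sub_pos.2 hy)
      exact ⟨n, by linarith⟩
    · rintro ⟨n, hn⟩
      have : (0 : ℝ) < 1 / ((n : ℝ) + 1) := by positivity
      linarith
  have hmono : Monotone fun n : ℕ => Metric.ball x (t - 1 / ((n : ℝ) + 1)) := by
    intro m n hmn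
    refine Metric.ball_subset_ball ?_
    have := one_div_le_one_div_of_le (by positivity : (0 : ℝ) < (m : ℝ) + 1)
      (by exact_mod_cast Nat.succ_le_succ hmn : (m : ℝ) + 1 ≤ (n : ℝ) + 1)
    linarith
  have hlim := tendsto_measure_iUnion_atTop (μ := ν) hmono
  rw [← hU] at hlim
  have hlim' := (ENNReal.tendsto_toReal (measure_ne_top ν (Metric.ball x t))).comp hlim
  obtain ⟨n, hn⟩ := (hlim'.eventually_const_lt hxt).exists
  refine ⟨1 / ((n : ℝ) + 1), by positivity, fun y hy => ?_⟩
  simp only [Set.mem_compl_iff, Set.mem_ofPred_eq, not_forall, not_le]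
  refine ⟨t, ht, hn.trans_le (measureReal_mono (Metric.ball_subset_ball' ?_))⟩
  rw [Metric.mem_ball'] at hy
  linarith

omit [MeasurableSpace X] [BorelSpace X] in
-- By contraposition, each z too far from `A` at scale r forbids an open ball of radius 6r around z.
theorem isClosed_infDist_bound {A : Set X} (hA : IsClosed A) (n r₀ : ℝ) :
    IsClosed {x | x ∈ A ∧ ∀ r : ℝ, 0 < r → r < r₀ → ∀ z ∈ Metric.ball x (6 * r),
      Metric.infDist z A ≤ r / n} := by
  have : {x | x ∈ A ∧ ∀ r : ℝ, 0 < r → r < r₀ → ∀ z ∈ Metric.ball x (6 * r),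
      Metric.infDist z A ≤ r / n} = A ∩ ⋂ (r : ℝ) (_ : 0 < r) (_ : r < r₀) (z : X)
        (_ : ¬ Metric.infDist z A ≤ r / n), (Metric.ball z (6 * r))ᶜ := by
    ext x
    simp only [Set.mem_ofPred_eq, Set.mem_inter_iff, Set.mem_iInter, Set.mem_compl_iff]
    refine and_congr_right fun _ => forall₄_congr fun r _ _ z => ?_
    rw [Metric.mem_ball_comm, not_imp_not]
  rw [this]
  exact hA.inter (isClosed_iInter fun r => isClosed_iInter fun _ => isClosed_iInter fun _ =>
    isClosed_iInter fun z => isClosed_iInter fun _ => Metric.isOpen_ball.isClosed_compl)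

/-- Near almost every point of a set, the set is arbitrarily dense at small scales. -/
theorem VolumeBounds.ae_infDist_le [CompactSpace X] (hV : VolumeBounds μ Q c C R)
    {A : Set X} (hA : MeasurableSet A) :
    ∀ᵐ x ∂μ, x ∈ A → ∀ n : ℕ, 0 < n → ∃ k : ℕ, ∀ r : ℝ, 0 < r → r < 1 / ((k : ℝ) + 1) →
      ∀ z ∈ Metric.ball x (6 * r), Metric.infDist z A ≤ r / n := by
  have := hV.isUnifLocDoublingMeasure
  have hc := hV.c_pos
  have hC := hV.C_pos
  have hR := hV.R_pos
  rw [← ae_restrict_iff' hA]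
  filter_upwards [IsUnifLocDoublingMeasure.ae_tendsto_measure_inter_div μ A 1,
    ae_restrict_mem hA] with x hx hxA n hn
  have hn' : (0 : ℝ) < n := by exact_mod_cast hn
  have hn1 : (1 : ℝ) ≤ n := by exact_mod_cast hn
  have hδ : Tendsto (fun r : ℝ => 7 * r) (𝓝[>] 0) (𝓝[>] 0) := by
    refine tendsto_nhdsWithin_iff.2 ⟨?_, ?_⟩
    · have : Tendsto (fun r : ℝ => 7 * r) (𝓝 0) (𝓝 (7 * 0)) := tendsto_id.const_mul 7
      rw [mul_zero] at this
      exact this.mono_left nhdsWithin_le_nhds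
    · filter_upwards [self_mem_nhdsWithin] with r hr
      have : (0 : ℝ) < r := hr
      exact Set.mem_Ioi.2 (by positivity)
  have h1 := hx (l := 𝓝[>] (0 : ℝ)) (fun _ => x) (fun r => 7 * r) hδ (by
    filter_upwards [self_mem_nhdsWithin] with r hr
    have : (0 : ℝ) < r := hr
    simp only [one_mul]
    exact Metric.mem_closedBall_self (by positivity))
  have h2 := (ENNReal.tendsto_toReal ENNReal.one_ne_top).comp h1
  -- A lower bound for the share of a ball of radius r/n in a closed ball of radius 7r (8r leaves
  -- room for an open ball). A hole of that size in `A` contradicts density above 1 - κ.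
  set κ : ℝ := c / (C * (8 * n) ^ Q) with hκ
  have hκ0 : 0 < κ := by positivity
  have h3 := h2.eventually_const_lt (show 1 - κ < (1 : ℝ≥0∞).toReal by simp [hκ0])
  obtain ⟨r₁, hr₁, hsub⟩ := mem_nhdsGT_iff_exists_Ioc_subset.1 h3
  obtain ⟨k, hk⟩ := exists_nat_one_div_lt (lt_min (show 0 < r₁ from hr₁) hR)
  refine ⟨k, fun r hr hrk z hz => ?_⟩
  have hr1 : r ≤ r₁ := (hrk.trans hk).le.trans (min_le_left _ _)
  have hrR : r ≤ R := (hrk.trans hk).le.trans (min_le_right _ _)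
  by_contra! hfar
  have hrn : r / n ≤ r := div_le_self hr.le hn1
  have hdisj : Disjoint (A ∩ Metric.closedBall x (7 * r)) (Metric.ball z (r / n)) := by
    rw [Set.disjoint_left]
    rintro y ⟨hyA, -⟩ hyz
    have := Metric.infDist_le_dist_of_mem (x := z) hyA
    rw [Metric.mem_ball'] at hyz
    linarith
  have hsubset : A ∩ Metric.closedBall x (7 * r) ∪ Metric.ball z (r / n) ⊆
      Metric.closedBall x (7 * r) := by
    refine Set.union_subset Set.inter_subset_right fun y hy => ?_
    rw [Metric.mem_closedBall]
    rw [Metric.mem_ball] at hy hz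
    linarith [dist_triangle y z x]
  have h4 := measureReal_mono (μ := μ) hsubset
  rw [measureReal_union hdisj measurableSet_ball] at h4
  have h5 := hV.lower z (r / n) (by positivity) (hrn.trans hrR)
  have h6 := hV.closedBall_le x (by positivity : 0 ≤ 7 * r) (by linarith : 7 * r < 8 * r)
  have h7 : 1 - κ < μ.real (A ∩ Metric.closedBall x (7 * r)) /
      μ.real (Metric.closedBall x (7 * r)) := by
    have : 1 - κ < (μ (A ∩ Metric.closedBall x (7 * r)) /
      μ (Metric.closedBall x (7 * r))).toReal := hsub ⟨hr, hr1⟩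
    rwa [ENNReal.toReal_div] at this
  have hb : 0 < μ.real (Metric.closedBall x (7 * r)) :=
    (show 0 < c * r ^ Q by positivity).trans_le
      ((hV.le_closedBall x hr hrR).trans
        (measureReal_mono (Metric.closedBall_subset_closedBall (by linarith))))
  rw [lt_div_iff₀ hb] at h7
  have h8 : κ * (C * (8 * r) ^ Q) = c * (r / n) ^ Q := by
    rw [hκ, Real.mul_rpow (by norm_num) hn'.le, Real.mul_rpow (by norm_num) hr.le,
      Real.div_rpow hr.le hn'.le]
    field_simp
  have h9 := mul_le_mul_of_nonneg_left h6 hκ0.le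
  linarith

end Density

/-! ### Singularity of energy measures and of the dominant measure -/

section Singular

variable {X : Type*} [MetricSpace X] [MeasurableSpace X] [BorelSpace X] {p β : ℝ}
  {μ : Measure X} {S : EnergyData X p μ}

/-- The energy of a function on a set near which its energy density is bounded on a
sufficiently dense set. -/
theorem IsPoincareDirichletSpace.exists_energy_le [CompactSpace X] [Nonempty X]
    [IsFiniteMeasure μ] (hS : IsPoincareDirichletSpace S β) (hgeo : IsGeodesic X) (hp : 1 ≤ p)
    (hβ : 0 < β) {Q c C R : ℝ} (hQ : 0 ≤ Q) (hV : VolumeBounds μ Q c C R) (f : S.F) :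
    ∃ K : ℝ, 0 ≤ K ∧ ∀ (n : ℕ) (A D : Set X) (M r₀ : ℝ), 0 < n → MeasurableSet D → 0 ≤ M →
      0 < r₀ → (∀ a ∈ A, ∀ t : ℝ, 0 < t → (S.Γ f).real (Metric.ball a t) ≤ M * t ^ Q) →
      (∀ y ∈ D, ∀ r : ℝ, 0 < r → r < r₀ → ∀ z ∈ Metric.ball y (6 * r),
        ∃ a ∈ A, dist z a < 2 * (r / n)) →
      S.Γ f D ≤ ENNReal.ofReal (K * M * (n : ℝ) ^ (p - β)) := by
  have hp0 : 0 < p := by linarith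
  have hD := hS.toIsDirichletSpace
  obtain ⟨K, hK, hdisc⟩ := hS.exists_discretization hgeo hp hQ hV f
  refine ⟨K, hK, fun n A D M r₀ hn hDm hM hr₀ hA hAD => ?_⟩
  obtain ⟨J, hJ, hJr⟩ := hdisc n hn
  have hR := hV.R_pos
  -- Scales tending to zero, at most `R` and strictly below `r₀`.
  set ρ : ℕ → ℝ := fun i => min (r₀ / 2) R / ((i : ℝ) + 1) with hρ
  have hmin : 0 < min (r₀ / 2) R := lt_min (by positivity) hR
  have hρ0 : ∀ i, 0 < ρ i := fun i => by positivity
  have hρle : ∀ i, ρ i ≤ min (r₀ / 2) R := fun i => by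
    refine div_le_self hmin.le ?_
    have : (0 : ℝ) ≤ i := i.cast_nonneg
    linarith
  choose u hu hE hloc using fun i => hJr (ρ i) (hρ0 i) ((hρle i).trans (min_le_right _ _))
  have hρlim : Tendsto ρ atTop (𝓝 0) :=
    tendsto_const_nhds.div_atTop (tendsto_natCast_atTop_atTop.atTop_add tendsto_const_nhds)
  have hlim : Tendsto (fun i => ‖(u i : Lp ℝ (ENNReal.ofReal p) μ) - f‖) atTop (𝓝 0) := by
    have h1 : Tendsto (fun i => (J * ρ i ^ β) ^ (1 / p)) atTop (𝓝 0) := by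
      have h2 := (((Real.continuousAt_rpow_const 0 β (Or.inr hβ.le)).tendsto.comp hρlim).const_mul
        J)
      rw [Real.zero_rpow hβ.ne', mul_zero] at h2
      have h3 := (Real.continuousAt_rpow_const 0 (1 / p)
        (Or.inr (by positivity))).tendsto.comp h2
      rwa [Real.zero_rpow (by positivity)] at h3
    refine squeeze_zero (fun i => ENNReal.toReal_nonneg) (fun i => ?_) h1
    have h0 : 0 ≤ ‖(u i : Lp ℝ (ENNReal.ofReal p) μ) - f‖ := ENNReal.toReal_nonneg
    have h4 := Real.rpow_le_rpow (by positivity) (hu i) (by positivity : 0 ≤ 1 / p)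
    rwa [← Real.rpow_mul h0, mul_one_div_cancel hp0.ne', Real.rpow_one] at h4
  have hbdd : BddAbove (Set.range fun i => S.E (u i)) := by
    refine ⟨J.toNNReal, ?_⟩
    rintro _ ⟨i, rfl⟩
    have h1 := hE i
    rw [measureReal_def, hD.Γ_univ, ENNReal.coe_toReal] at h1
    exact NNReal.le_toNNReal_of_coe_le h1
  obtain ⟨hf, hle⟩ := hD.lower_semicontinuous f u hlim hbdd
  refine (hle D hDm).trans (liminf_le_of_frequently_le' (Frequently.of_forall fun i => ?_))
  have := hD.isFiniteMeasure (u i)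
  rw [← ofReal_measureReal]
  exact ENNReal.ofReal_le_ofReal (hloc i A D M hM hA fun y hy z hz =>
    hAD y hy (ρ i) (hρ0 i) ((hρle i).trans_lt ((min_le_left _ _).trans_lt (by linarith))) z hz)

/-- If the walk dimension exceeds `p` in a geodesic space, then energy measures are singular. -/
theorem IsPoincareDirichletSpace.mutuallySingular_energy [CompactSpace X] [Nonempty X]
    [IsFiniteMeasure μ] (hS : IsPoincareDirichletSpace S β) (hgeo : IsGeodesic X) (hp : 1 ≤ p)
    (hβ : p < β) {Q c C R : ℝ} (hQ : 0 ≤ Q) (hV : VolumeBounds μ Q c C R) (f : S.F) :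
    S.Γ f ⟂ₘ μ := by
  have := hS.toIsDirichletSpace.isFiniteMeasure f
  obtain ⟨K, hK, hle⟩ := hS.exists_energy_le hgeo hp (by linarith) hQ hV f
  set A : ℕ → Set X := fun M => {x | ∀ t : ℝ, 0 < t → (S.Γ f).real (Metric.ball x t) ≤ M * t ^ Q}
    with hA
  have hAc : ∀ M, IsClosed (A M) := fun M => isClosed_density_bound _ _
  set D : ℕ → ℕ → ℕ → Set X := fun M n k => {x | x ∈ A M ∧ ∀ r : ℝ, 0 < r →
    r < 1 / ((k : ℝ) + 1) → ∀ z ∈ Metric.ball x (6 * r),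
      Metric.infDist z (A M) ≤ r / (n + 1 : ℕ)} with hDdef
  have hDc : ∀ M n k, IsClosed (D M n k) := fun M n k => isClosed_infDist_bound (hAc M) _ _
  have hDle : ∀ M n k, S.Γ f (D M n k) ≤
      ENNReal.ofReal (K * M * ((n + 1 : ℕ) : ℝ) ^ (p - β)) := by
    intro M n k
    refine hle (n + 1) (A M) (D M n k) M (1 / ((k : ℝ) + 1)) n.succ_pos (hDc M n k).measurableSet
      M.cast_nonneg (by positivity) (fun a ha => ha) fun y hy r hr hrk z hz => ?_
    have h1 := hy.2 r hr hrk z hz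
    have h2 : 0 < r / (n + 1 : ℕ) := by positivity
    -- The factor 2 leaves the room needed to pass from the infimum to an actual point of `A M`.
    exact (Metric.infDist_lt_iff ⟨y, hy.1⟩).1 (by linarith)
  have hDmono : ∀ M n, Monotone (D M n) := by
    intro M n k l hkl x hx
    refine ⟨hx.1, fun r hr hrl => hx.2 r hr (hrl.trans_le ?_)⟩
    exact one_div_le_one_div_of_le (by positivity) (by exact_mod_cast Nat.succ_le_succ hkl)
  -- The bound does not depend on the scale threshold 1/(k+1), so it survives the increasing union.
  have hDU : ∀ M n, S.Γ f (⋃ k, D M n k) ≤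
      ENNReal.ofReal (K * M * ((n + 1 : ℕ) : ℝ) ^ (p - β)) := by
    intro M n
    rw [(hDmono M n).measure_iUnion]
    exact iSup_le (hDle M n)
  have hzero : ∀ M, S.Γ f (⋂ n, ⋃ k, D M n k) = 0 := by
    intro M
    have hlim : Tendsto (fun n : ℕ => ENNReal.ofReal (K * M * ((n + 1 : ℕ) : ℝ) ^ (p - β))) atTop
        (𝓝 0) := by
      have h1 := (tendsto_rpow_neg_atTop (sub_pos.2 hβ)).comp
        (tendsto_natCast_atTop_atTop.comp (tendsto_add_atTop_nat 1))
      rw [neg_sub] at h1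
      have h2 := ENNReal.tendsto_ofReal (h1.const_mul (K * M))
      rwa [mul_zero, ENNReal.ofReal_zero] at h2
    exact le_antisymm (ge_of_tendsto' hlim fun n =>
      (measure_mono (Set.iInter_subset _ n)).trans (hDU M n)) zero_le
  refine ⟨⋃ M, ⋂ n, ⋃ k, D M n k, MeasurableSet.iUnion fun M => MeasurableSet.iInter fun n =>
    MeasurableSet.iUnion fun k => (hDc M n k).measurableSet, measure_iUnion_null hzero, ?_⟩
  have hae : ∀ᵐ x ∂μ, x ∈ ⋃ M, ⋂ n, ⋃ k, D M n k := by
    filter_upwards [hV.ae_exists_density_bound hQ (S.Γ f),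
      ae_all_iff.2 fun M => hV.ae_infDist_le (hAc M).measurableSet] with x ⟨M, hM⟩ hx
    simp only [Set.mem_iUnion, Set.mem_iInter]
    exact ⟨M, fun n => (hx M hM (n + 1) n.succ_pos).imp fun k hk => ⟨hM, hk⟩⟩
  exact hae

/-- Two distinct points make the diameter positive, so regularity covers a range of radii. Beyond
twice the diameter balls no longer grow, and the upper bound persists. -/
theorem IsAhlforsRegular.exists_volumeBounds [CompactSpace X] [Nontrivial X] {Q : ℝ} (hQ : 0 ≤ Q)
    [IsFiniteMeasure (μH[Q] : Measure X)] (h : IsAhlforsRegular X Q) :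
    ∃ c C R : ℝ, VolumeBounds (μH[Q] : Measure X) Q c C R := by
  obtain ⟨C, hC1, hC⟩ := h
  have hC0 : 0 < C := by linarith
  set d := Metric.diam (Set.univ : Set X) with hd
  have hbdd := (isCompact_univ (X := X)).isBounded
  have hd0 : 0 < d := Metric.diam_pos Set.nontrivial_univ hbdd
  have hed : 2 * Metric.ediam (Set.univ : Set X) = ENNReal.ofReal (2 * d) := by
    rw [ENNReal.ofReal_mul (by norm_num), hd, Metric.diam,
      ENNReal.ofReal_toReal hbdd.ediam_ne_top, ENNReal.ofReal_ofNat]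
  have hup : ∀ (x : X) (r : ℝ), 0 < r → r ≤ 2 * d →
      (μH[Q] : Measure X).real (Metric.ball x r) ≤ C * r ^ Q := by
    intro x r hr hrd
    have h1 := (hC x r hr (hed ▸ ENNReal.ofReal_le_ofReal hrd)).2
    rwa [← ofReal_measureReal, ENNReal.ofReal_le_ofReal_iff (by positivity)] at h1
  refine ⟨C⁻¹, C, d, by positivity, hC0, hd0, fun x r hr hrd => ?_, fun x r hr => ?_⟩
  · have h1 := (hC x r hr (hed ▸ ENNReal.ofReal_le_ofReal (by linarith))).1
    rwa [← ofReal_measureReal, ENNReal.ofReal_le_ofReal_iff measureReal_nonneg] at h1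
  · rcases le_or_gt r (2 * d) with hrd | hrd
    · exact hup x r hr hrd
    · have hsub : Metric.ball x r ⊆ Metric.ball x (2 * d) := fun y _ => by
        have := Metric.dist_le_diam_of_mem hbdd (Set.mem_univ y) (Set.mem_univ x)
        rw [Metric.mem_ball]
        linarith
      calc _ ≤ (μH[Q] : Measure X).real (Metric.ball x (2 * d)) := measureReal_mono hsub
        _ ≤ C * (2 * d) ^ Q := hup x _ (by positivity) le_rfl
        _ ≤ C * r ^ Q := by gcongr

/-- If all energy measures are singular, so is every minimal energy dominant measure. -/
theorem IsMinimalEnergyDominant.mutuallySingular [CompactSpace X] [IsFiniteMeasure μ]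
    {Λ : Measure X} (hΛ : IsMinimalEnergyDominant S Λ) (h : ∀ f : S.F, S.Γ f ⟂ₘ μ) : Λ ⟂ₘ μ := by
  have := hΛ.radon.locallyFinite
  -- The singular part of `Λ` vanishes on `N` and `μ` vanishes on its complement, so on `N` the
  -- measure `Λ` is absolutely continuous with respect to `μ`.
  set N := (Measure.mutuallySingular_singularPart Λ μ).nullSet with hN
  have hNm : MeasurableSet N := (Measure.mutuallySingular_singularPart Λ μ).measurableSet_nullSet
  have hac : ∀ A : Set X, μ A = 0 → Λ (A ∩ N) = 0 := by
    intro A hA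
    conv_lhs => rw [← Measure.singularPart_add_rnDeriv Λ μ]
    rw [Measure.add_apply, measure_mono_null Set.inter_subset_right
      (Measure.mutuallySingular_singularPart Λ μ).measure_nullSet,
      withDensity_absolutelyContinuous _ _ (measure_mono_null Set.inter_subset_left hA), add_zero]
  have hdom : IsEnergyDominant S (Λ.restrict Nᶜ) := by
    refine ⟨⟨inferInstance, inferInstance⟩, fun f => ?_⟩
    refine Measure.AbsolutelyContinuous.mk fun A hAm hA => ?_
    rw [Measure.restrict_apply hAm] at hA
    obtain ⟨T, hT, hT0, hTc⟩ := h f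
    have h1 : S.Γ f (A ∩ Nᶜ) = 0 := hΛ.dominates f hA
    -- `S.Γ f` lives on the μ-null set Tᶜ, whose part in `N` is Λ-null. So no energy measure charges
    -- `N`.
    have h2 : S.Γ f (Tᶜ ∩ N) = 0 := hΛ.dominates f (hac _ hTc)
    refine measure_mono_null (t := T ∪ (A ∩ Nᶜ) ∪ (Tᶜ ∩ N)) (fun x hx => ?_)
      (measure_union_null (measure_union_null hT0 h1) h2)
    by_cases hxT : x ∈ T
    · exact Or.inl (Or.inl hxT)
    · by_cases hxN : x ∈ N
      · exact Or.inr ⟨hxT, hxN⟩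
      · exact Or.inl (Or.inr ⟨hx, hxN⟩)
  refine ⟨N, hNm, ?_, (Measure.mutuallySingular_singularPart Λ μ).measure_compl_nullSet⟩
  exact hΛ.minimal _ hdom (by rw [Measure.restrict_apply hNm]; simp)

end Singular

end PDirichlet

theorem proposition5p1 {X : Type*} [MetricSpace X] [MeasurableSpace X] [BorelSpace X]
    [CompactSpace X] (p β dH : ℝ) (hp : 1 < p) (hβ : 0 < β) (hdH : 0 < dH)
    (μ : Measure X) (hμ : μ = μH[dH])
    (S : PDirichlet.EnergyData X p μ)
    (hS : PDirichlet.IsPoincareDirichletSpace S β)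
    (hAR : PDirichlet.IsAhlforsRegular X dH)
    (hBT : PDirichlet.IsBoundedTurning X)
    (hgeo : PDirichlet.IsGeodesic X) (hβp : p < β)
    (Λ : Measure X) (hΛ : PDirichlet.IsMinimalEnergyDominant S Λ) :
    Measure.MutuallySingular Λ μ := by
  subst hμ
  have := hS.radon.locallyFinite
  rcases subsingleton_or_nontrivial X with hX | hX
  -- With at most one point the diameter is zero and regularity says nothing, but Hausdorff measure
  -- of positive dimension vanishes.
  · have := Measure.nullSingletonClass_hausdorff X hdH
    have h0 : (μH[dH] : Measure X) = 0 :=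
      Measure.measure_univ_eq_zero.1 (Set.subsingleton_univ.measure_zero _)
    rw [h0]
    exact Measure.MutuallySingular.zero_right
  · obtain ⟨c, C, R, hV⟩ := hAR.exists_volumeBounds hdH.le
    exact hΛ.mutuallySingular fun f =>
      hS.mutuallySingular_energy hgeo hp.le hβp hdH.le hV f
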